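/- Let $N\ge 1$ and $0<\varepsilon<1$. A \emph{schedule} is a set $X$ of crosspoints $(i,j)\in\{1,\dots,N\}^2$ containing at most one crosspoint in each row and at most one in each column; two distinct crosspoints are \emph{neighbors} if they share a row or a column. Let $\mathcal X$ be the set of all schedules. Let $g$ be differentiable on $[0,\infty)$ with $g\ge 1$ and $g'\ge 0$, put $f(x)=\log(1+x)/g(x)$, and suppose that $f$ has an inverse $f^{-1}$ on $[0,\infty)$ (i.e. $f$ is a bijection of $[0,\infty)$ onto itself) and that $\lim_{x\to\infty}g(f^{-1}(x))=\infty$. A \emph{queue path} is a sequence $Q(n)=(Q_{ij}(n))_{1\le i,j\le N}$, $n\ge0$, of matrices of nonnegative integers with $|Q_{ij}(n+1)-Q_{ij}(n)|\le 1$. Let $\|Q(n)\|=(\sum_{i,j}Q_{ij}(n)^2)^{1/2}$, $Q_{\max}(n)=\max_{i,j}Q_{ij}(n)$, $$\tilde Q_{ij}(n)=\max\Big\{f^{-1}\Big(\tfrac{\varepsilon}{2N^2}f(Q_{\max}(n))\Big),\,Q_{ij}(n)\Big\},\quad W_{ij}(n)=f(\tilde Q_{ij}(n)),\quad p_{ij}(n)=\frac{e^{W_{ij}(n)}}{1+e^{W_{ij}(n)}},$$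 and $W_{\max}(n)=\max_{i,j}W_{ij}(n)$. The DISQUO chain $X(0),X(1),\dots$ in $\mathcal X$ along the queue path is the time-inhomogeneous Markov chain that starts from an arbitrary initial law and in which $X(n)$, $n\ge1$, is obtained from $X(n-1)$ as follows. Draw a uniformly random permutation $\sigma$ of $\{1,\dots,N\}$ and let $H=\{(i,\sigma(i))\}$. Crosspoints outside $H$ keep their state. Independently of each other, each crosspoint $(i,j)\in H$ that lies in $X(n-1)$ or has no neighbor in $X(n-1)$ is put in $X(n)$ with probability $p_{ij}(n)$ and left out otherwise. The remaining crosspoints of $H$ are left out of $X(n)$. Let $P_n$ be the transition matrix of this step (defined by the same rule with the weights $W(n)$ also for $n=0$), $\mu_n$ the law of $X(n)$, and $$\pi_n(X)=\frac{\exp\big(\sum_{(i,j)\in X}W_{ij}(n)\big)}{\sum_{Y\in\mathcal X}\exp\big(\sum_{(i,j)\in Y}W_{ij}(n)\big)},\quad \|\mu-\nu\|_{TV}=\tfrac12\sum_{X\in\mathcal X}|\mu(X)-\nu(X)|,$$ $$T_n=\frac1{1-e_{\max}(n)},\quad e_{\max}(n)=\max\{|e|:\ e\text{ an eigenvalue of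 }P_n,\ |e|\ne1\},\quad \alpha_n=\sum_{i,j}\big[f'(\tilde Q_{ij}(n))+f'(\tilde Q_{ij}(n+1))\big].$$ (At $0$, derivatives are one-sided.) Then the following hold for every $\delta>0$. 1. Suppose that $f$ is concave on $[0,\infty)$. For every queue path with $\alpha_nT_{n+1}\le\delta/8$ for all $n\ge0$, the number $$n^*=\min\Big\{n\ge0:\ \sum_{i=1}^n\frac1{T_i^2}\ \ge\ \log\frac2\delta+\frac{N^2}2\big(\log 2+W_{\max}(0)\big)\Big\}$$ exists (the set is nonempty), and for every initial law $\|\mu_n-\pi_n\|_{TV}\le\delta$ for all $n\ge n^*$. 2. There is a constant $C$, depending only on $N,\varepsilon,g,\delta$, such that for every queue path and every $n\ge0$ with $\|Q(n)\|>C$ one has $\alpha_nT_{n+1}\le\delta/8$. 3. There is a constant $C$, depending only on $N,\varepsilon,g,\delta$, such that for every queue path with $\|Q(n)\|>C$ for all sufficiently large $n$ there is an $n^*$ such that, for every initial law, $\|\mu_n-\pi_n\|_{TV}\le\delta$ for all $n\ge n^*$. -/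

import Mathlib

open Filter Topology

/-- A crosspoint `(i, j)` of an `N × N` switch: input `i`, output `j`. -/
abbrev Crosspoint (N : ℕ) : Type := Fin N × Fin N

/-- Two distinct crosspoints are neighbors when they share their input or their output. -/
def IsNeighbor {N : ℕ} (a b : Crosspoint N) : Prop :=
  a ≠ b ∧ (a.1 = b.1 ∨ a.2 = b.2)

/-- A DISQUO schedule, written as the set of its active crosspoints: every input and every
output has at most one active crosspoint. -/
def IsSchedule {N : ℕ} (X : Finset (Crosspoint N)) : Prop :=
  (∀ i : Fin N, (X.filter (fun c => c.1 = i)).card ≤ 1) ∧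
    (∀ j : Fin N, (X.filter (fun c => c.2 = j)).card ≤ 1)

/-- The finite state space of all DISQUO schedules. -/
abbrev Schedule (N : ℕ) : Type := {X : Finset (Crosspoint N) // IsSchedule X}

noncomputable instance instFintypeSchedule (N : ℕ) : Fintype (Schedule N) :=
  Fintype.ofFinite _

noncomputable instance instDecidableEqSchedule (N : ℕ) : DecidableEq (Schedule N) :=
  Classical.decEq _

/-- Total variation distance of two distributions on a finite space. -/
noncomputable def tvDist {Ω : Type*} [Fintype Ω] (μ ν : Ω → ℝ) : ℝ :=
  1 / 2 * ∑ x, |μ x - ν x|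

/-- Activation probability `exp w / (1 + exp w)` of a crosspoint of weight `w`. -/
noncomputable def actProb (w : ℝ) : ℝ := Real.exp w / (1 + Real.exp w)

open Classical in
/-- Probability that crosspoint `c` is active after one slot of the basic DISQUO algorithm, if
the previous schedule is `X` and the selected input/output permutation is
`H = {(i, σ i)}`. A crosspoint outside `H` keeps its state; a crosspoint of `H` that is active, or
that has no active neighbor, becomes active with probability `actProb (W c)`; a crosspoint of
`H` with an active neighbor becomes (or stays) inactive. -/
noncomputable def activeProb {N : ℕ} (W : Crosspoint N → ℝ) (σ : Equiv.Perm (Fin N))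
    (X : Finset (Crosspoint N)) (c : Crosspoint N) : ℝ :=
  if σ c.1 = c.2 then
    if c ∈ X ∨ ∀ d, IsNeighbor c d → d ∉ X then actProb (W c) else 0
  else
    if c ∈ X then 1 else 0

open Classical in
/-- One-slot transition matrix of the basic DISQUO algorithm with weights `W`: the permutation
is uniform among the `N!` permutations, and given it the crosspoints are updated independently. -/
noncomputable def transition {N : ℕ} (W : Crosspoint N → ℝ) :
    Matrix (Schedule N) (Schedule N) ℝ :=
  fun X Y => ∑ σ : Equiv.Perm (Fin N), (1 / (N.factorial : ℝ)) *
    ∏ c : Crosspoint N,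
      if c ∈ Y.1 then activeProb W σ X.1 c else 1 - activeProb W σ X.1 c

/-- The product-form distribution with weights `W`. -/
noncomputable def productForm {N : ℕ} (W : Crosspoint N → ℝ) (X : Schedule N) : ℝ :=
  Real.exp (∑ c ∈ X.1, W c) / ∑ Y : Schedule N, Real.exp (∑ c ∈ Y.1, W c)

/-- `max {|e| : |e| ≠ 1, e an eigenvalue of P}`. It is used for reversible transition matrices
only, all of whose eigenvalues are real. -/
noncomputable def eMax {Ω : Type*} [Fintype Ω] [DecidableEq Ω] (P : Matrix Ω Ω ℝ) : ℝ :=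
  sSup {r : ℝ | ∃ e : ℝ, Module.End.HasEigenvalue (Matrix.toLin' P) e ∧ |e| ≠ 1 ∧ r = |e|}

/-- The mixing time `1 / (1 - e_max)` of the multiple-update Glauber dynamics with weights `W`. -/
noncomputable def mixTime {N : ℕ} (W : Crosspoint N → ℝ) : ℝ :=
  1 / (1 - eMax (transition W))

/-- The weight function `f(x) = log (1 + x) / g(x)`. -/
noncomputable def weightFun (g : ℝ → ℝ) (x : ℝ) : ℝ := Real.log (1 + x) / g x

/-- The inverse of `f : [0, ∞) → [0, ∞)`. -/
noncomputable def invOnNonneg (f : ℝ → ℝ) : ℝ → ℝ := Function.invFunOn f (Set.Ici 0)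

/-- The longest queue length. -/
def qMax {N : ℕ} (q : Crosspoint N → ℕ) : ℕ := Finset.univ.sup q

/-- The norm `(∑ Q_ij ^ 2) ^ (1 / 2)` of a matrix of queue lengths. -/
noncomputable def qNorm {N : ℕ} (q : Crosspoint N → ℕ) : ℝ := Real.sqrt (∑ c, (q c : ℝ) ^ 2)

/-- The modified queue lengths `max (f⁻¹ (ε / (2 N²) * f (Q_max))) Q_ij`. -/
noncomputable def qTilde {N : ℕ} (f : ℝ → ℝ) (ε : ℝ) (q : Crosspoint N → ℕ)
    (c : Crosspoint N) : ℝ :=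
  max (invOnNonneg f (ε / (2 * (N : ℝ) ^ 2) * f (qMax q))) (q c)

/-- The weights `W_ij = f (Q̃_ij)`. -/
noncomputable def weight {N : ℕ} (f : ℝ → ℝ) (ε : ℝ) (q : Crosspoint N → ℕ)
    (c : Crosspoint N) : ℝ :=
  f (qTilde f ε q c)

/-- A possible path of the queue lengths: in a slot a queue has at most one arrival and at most
one departure. -/
def IsQueuePath {N : ℕ} (Q : ℕ → Crosspoint N → ℕ) : Prop :=
  ∀ n c, Q (n + 1) c ≤ Q n c + 1 ∧ Q n c ≤ Q (n + 1) c + 1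

/-- The law `μ_n` of the schedule `X(n)` along the queue path `Q`, where `X(0)` has law `μ₀`:
the schedule `X(n + 1)` is generated from `X(n)` with the weights of time `n + 1`. -/
noncomputable def scheduleLaw {N : ℕ} (f : ℝ → ℝ) (ε : ℝ) (Q : ℕ → Crosspoint N → ℕ)
    (μ₀ : Schedule N → ℝ) : ℕ → Schedule N → ℝ
  | 0 => μ₀
  | n + 1 => Matrix.vecMul (scheduleLaw f ε Q μ₀ n) (transition (weight f ε (Q (n + 1))))

/-- `α_n = ∑_ij (f' (Q̃_ij(n)) + f' (Q̃_ij(n+1)))`, with the one-sided derivative at `0`. -/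
noncomputable def alphaSeq {N : ℕ} (f : ℝ → ℝ) (ε : ℝ) (Q : ℕ → Crosspoint N → ℕ) (n : ℕ) : ℝ :=
  ∑ c : Crosspoint N, (derivWithin f (Set.Ici 0) (qTilde f ε (Q n) c) +
    derivWithin f (Set.Ici 0) (qTilde f ε (Q (n + 1)) c))

/-- `T_n`, the mixing time for the weights of time `n`. -/
noncomputable def mixTimeAt {N : ℕ} (f : ℝ → ℝ) (ε : ℝ) (Q : ℕ → Crosspoint N → ℕ) (n : ℕ) : ℝ :=
  mixTime (weight f ε (Q n))

/-- The largest weight. -/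
noncomputable def maxWeight {N : ℕ} (W : Crosspoint N → ℝ) : ℝ := ⨆ c, W c

/-- The times `n` with `∑_{i=1}^n 1 / T_i² ≥ log (2 / δ) + N² / 2 * (log 2 + W_max(0))`. -/
def convergenceTimes {N : ℕ} (f : ℝ → ℝ) (ε δ : ℝ) (Q : ℕ → Crosspoint N → ℕ) : Set ℕ :=
  {n | Real.log (2 / δ) + (N : ℝ) ^ 2 / 2 * (Real.log 2 + maxWeight (weight f ε (Q 0))) ≤
    ∑ i ∈ Finset.Icc 1 n, 1 / (mixTimeAt f ε Q i) ^ 2}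

/-!
For fixed weights, the slot kernel averages, over the random permutation, kernels that resample
the selected crosspoints from the product form `π` conditionally on the others; so it is reversible
with respect to `π` (`transition_reversible`). Since every schedule extends to a permutation, the
empty schedule is reached from anywhere in one slot with probability at least
`1 / (N! (1 + exp W_max) ^ N²)` (`le_transition_empty`). This Doeblin bound contracts oscillations,
so it keeps the modulus of every eigenvalue with a non-constant eigenvector away from one and
gives `T ≤ const * exp (N² W_max)`. By the spectral theorem the kernel contracts signed measures of
mass zero in `L²(1/π)` by the factor `eMax = 1 - 1 / T` (`chiNorm_vecMul_le`).

If the weights change by `β` in total in a slot, `π` changes pointwise by a factor at most `exp β`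
(`productForm_le_exp_mul`), so the chi-square distance `a` from the law to `π` satisfies
`a' ≤ (1 - 1 / T) (exp (β / 2) a + exp β - 1)` (`chiNorm_step`). When `β T ≤ δ / 8` and `δ ≤ 1`, the
excess of `a` over `δ` therefore shrinks by the factor `exp (-1 / T²)` (`excess_contraction`). The
initial distance is at most `exp (N² (log 2 + W_max) / 2)`, which gives the time `n*`. It exists
because queues grow linearly whereas `exp (K f(x)) = O(x)` for all `K`, as `g → ∞`, so that
`∑ 1 / T²` diverges (`exists_le_sum_mixTime`). For `δ ≥ 1` the bound on the distance is trivial.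

It remains to bound the drift `β`. Let `h = f⁻¹ (ε / (2 N²) f(Q_max))` be the floor of the modified
queue lengths. Since `f' ≤ 1 / (1 + x)`, both `α_n` and the drift are at most the sum over the
crosspoints of `1 / (1 + h(n)) + 1 / (1 + h(n+1))`, and for long queues
`1 + h = exp (g(h) ε / (2 N²) f(Q_max))` dominates the bound on `T`
(`exists_floor_mul_mixTime_le`); no concavity is needed here. If `f` is concave, the modified
queue lengths change by at most one per slot and the drift is at most `α_n`
(`sum_abs_weight_sub_le_alphaSeq`).
-/

/-! ### The one-slot kernel of the basic algorithm -/

lemma IsNeighbor.symm {N : ℕ} {a b : Crosspoint N} (h : IsNeighbor a b) : IsNeighbor b a :=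
  ⟨h.1.symm, h.2.imp Eq.symm Eq.symm⟩

lemma isSchedule_iff {N : ℕ} {X : Finset (Crosspoint N)} :
    IsSchedule X ↔ ∀ a ∈ X, ∀ b ∈ X, ¬ IsNeighbor a b := by
  simp only [IsSchedule, Finset.card_le_one, Finset.mem_filter, IsNeighbor]
  constructor
  · rintro ⟨h1, h2⟩ a ha b hb ⟨hne, h | h⟩
    · exact hne (h1 b.1 a ⟨ha, h⟩ b ⟨hb, rfl⟩)
    · exact hne (h2 b.2 a ⟨ha, h⟩ b ⟨hb, rfl⟩)
  · intro h
    refine ⟨fun i a ha b hb => ?_, fun i a ha b hb => ?_⟩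
    · by_contra hne
      exact h a ha.1 b hb.1 ⟨hne, Or.inl (ha.2.trans hb.2.symm)⟩
    · by_contra hne
      exact h a ha.1 b hb.1 ⟨hne, Or.inr (ha.2.trans hb.2.symm)⟩

lemma isSchedule_empty (N : ℕ) : IsSchedule (∅ : Finset (Crosspoint N)) := by
  simp [isSchedule_iff]

instance instNonemptySchedule (N : ℕ) : Nonempty (Schedule N) := ⟨⟨∅, isSchedule_empty N⟩⟩

lemma actProb_pos (w : ℝ) : 0 < actProb w := by unfold actProb; positivity

lemma one_sub_actProb (w : ℝ) : 1 - actProb w = 1 / (1 + Real.exp w) := by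
  unfold actProb
  have : (1 + Real.exp w) ≠ 0 := by positivity
  field_simp
  ring

lemma actProb_le_one (w : ℝ) : actProb w ≤ 1 := by
  have h : 0 < 1 / (1 + Real.exp w) := by positivity
  rw [← one_sub_actProb] at h
  linarith

section Kernel

variable {N : ℕ} (W : Crosspoint N → ℝ) (σ : Equiv.Perm (Fin N))

lemma activeProb_nonneg (X : Finset (Crosspoint N)) (c : Crosspoint N) :
    0 ≤ activeProb W σ X c := by
  unfold activeProb
  split_ifs <;> first | exact (actProb_pos _).le | norm_num

lemma activeProb_le_one (X : Finset (Crosspoint N)) (c : Crosspoint N) :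
    activeProb W σ X c ≤ 1 := by
  unfold activeProb
  split_ifs <;> first | exact actProb_le_one _ | norm_num

open Classical in
/-- The transition probability from `X` to `Y` given that the permutation `σ` is selected. -/
noncomputable def permKernel (X Y : Finset (Crosspoint N)) : ℝ :=
  ∏ c : Crosspoint N, if c ∈ Y then activeProb W σ X c else 1 - activeProb W σ X c

lemma transition_apply (X Y : Schedule N) :
    transition W X Y = ∑ σ : Equiv.Perm (Fin N), (1 / (N.factorial : ℝ)) * permKernel W σ X.1 Y.1 :=
  rfl

lemma permKernel_nonneg (X Y : Finset (Crosspoint N)) : 0 ≤ permKernel W σ X Y := by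
  refine Finset.prod_nonneg fun c _ => ?_
  split_ifs
  · exact activeProb_nonneg W σ X c
  · exact sub_nonneg.2 (activeProb_le_one W σ X c)

variable {σ}

/-- A selected crosspoint has no selected neighbor. -/
lemma IsNeighbor.not_selected {c d : Crosspoint N} (h : IsNeighbor c d) (hc : σ c.1 = c.2) :
    σ d.1 ≠ d.2 := by
  intro hd
  obtain ⟨hne, h | h⟩ := h
  · exact hne (Prod.ext h (by rw [← hc, ← hd, h]))
  · exact hne (Prod.ext (σ.injective (by rw [hc, hd, h])) h)

/-- The kernel only charges schedules. -/
lemma permKernel_eq_zero {X Y : Finset (Crosspoint N)} (hX : IsSchedule X) (hY : ¬ IsSchedule Y) :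
    permKernel W σ X Y = 0 := by
  rw [isSchedule_iff] at hX hY
  push Not at hY
  obtain ⟨a, ha, b, hb, hab⟩ := hY
  have key : activeProb W σ X a = 0 ∨ activeProb W σ X b = 0 := by
    by_contra! hcon
    obtain ⟨h1, h2⟩ := hcon
    unfold activeProb at h1 h2
    by_cases hsa : σ a.1 = a.2
    · have hsb := hab.not_selected hsa
      have hbX : b ∈ X := by by_contra hb'; simp [hsb, hb'] at h2
      rw [if_pos hsa] at h1
      have haX : a ∉ X := fun h => hX a h b hbX hab
      apply h1
      rw [if_neg]
      push Not
      exact ⟨haX, b, hab, hbX⟩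
    · have haX : a ∈ X := by by_contra ha'; simp [hsa, ha'] at h1
      by_cases hsb : σ b.1 = b.2
      · rw [if_pos hsb] at h2
        have hbX : b ∉ X := fun h => hX a haX b h hab
        apply h2
        rw [if_neg]
        push Not
        exact ⟨hbX, a, hab.symm, haX⟩
      · have hbX : b ∈ X := by by_contra hb'; simp [hsb, hb'] at h2
        exact hX a haX b hbX hab
  rcases key with h | h
  · exact Finset.prod_eq_zero (Finset.mem_univ a) (by rw [if_pos ha, h])
  · exact Finset.prod_eq_zero (Finset.mem_univ b) (by rw [if_pos hb, h])

variable (σ)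

lemma sum_permKernel (X : Schedule N) : ∑ Y : Schedule N, permKernel W σ X.1 Y.1 = 1 := by
  classical
  have h1 : ∑ Y : Finset (Crosspoint N), permKernel W σ X.1 Y = 1 := by
    have h := Finset.prod_add (fun c => activeProb W σ X.1 c)
      (fun c => 1 - activeProb W σ X.1 c) (Finset.univ : Finset (Crosspoint N))
    simp only [add_sub_cancel, Finset.prod_const_one, Finset.powerset_univ] at h
    rw [h]
    refine Finset.sum_congr rfl fun Y _ => ?_
    unfold permKernel
    rw [Finset.prod_ite]
    congr 1
    · exact Finset.prod_congr (by ext; simp) fun _ _ => rfl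
    · exact Finset.prod_congr (by ext; simp) fun _ _ => rfl
  rw [← h1]
  rw [← Finset.sum_subset (Finset.subset_univ (Finset.univ.filter IsSchedule))]
  · exact (Finset.sum_subtype _ (by simp) (fun Y => permKernel W σ X.1 Y)).symm
  · intro Y _ hY
    exact permKernel_eq_zero W X.2 (by simpa using hY)

variable {σ}

/-- The weight of a set of crosspoints as a product over all crosspoints. -/
lemma exp_sum_eq_prod [DecidableEq (Crosspoint N)] (X : Finset (Crosspoint N)) :
    Real.exp (∑ c ∈ X, W c) = ∏ c, if c ∈ X then Real.exp (W c) else 1 := by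
  rw [Real.exp_sum, Finset.prod_ite_mem, Finset.univ_inter]

variable (σ)

/-- Detailed balance holds for every fixed permutation: crosspoints outside the permutation do
not move, and given them the selected crosspoints are resampled from the product form. -/
lemma permKernel_reversible (X Y : Schedule N) :
    Real.exp (∑ c ∈ X.1, W c) * permKernel W σ X.1 Y.1 =
      Real.exp (∑ c ∈ Y.1, W c) * permKernel W σ Y.1 X.1 := by
  classical
  obtain ⟨X, hX⟩ := X
  obtain ⟨Y, hY⟩ := Y
  rw [isSchedule_iff] at hX hY
  simp only
  by_cases hag : ∀ c : Crosspoint N, σ c.1 ≠ c.2 → (c ∈ X ↔ c ∈ Y)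
  · rw [exp_sum_eq_prod, exp_sum_eq_prod]
    unfold permKernel
    rw [← Finset.prod_mul_distrib, ← Finset.prod_mul_distrib]
    refine Finset.prod_congr rfl fun c _ => ?_
    by_cases hc : σ c.1 = c.2
    · by_cases hel : ∀ d, IsNeighbor c d → d ∉ X
      · have hel' : ∀ d, IsNeighbor c d → d ∉ Y := fun d hd =>
          fun h => hel d hd ((hag d (hd.not_selected hc)).2 h)
        have e1 : activeProb W σ X c = actProb (W c) := by
          unfold activeProb; rw [if_pos hc, if_pos (Or.inr hel)]
        have e2 : activeProb W σ Y c = actProb (W c) := by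
          unfold activeProb; rw [if_pos hc, if_pos (Or.inr hel')]
        rw [e1, e2, one_sub_actProb]
        unfold actProb
        split_ifs <;> ring
      · push Not at hel
        obtain ⟨d, hd, hdX⟩ := hel
        have hdY := (hag d (hd.not_selected hc)).1 hdX
        have hcX : c ∉ X := fun h => hX c h d hdX hd
        have hcY : c ∉ Y := fun h => hY c h d hdY hd
        have e1 : activeProb W σ X c = 0 := by
          unfold activeProb; rw [if_pos hc, if_neg]; push Not; exact ⟨hcX, d, hd, hdX⟩
        have e2 : activeProb W σ Y c = 0 := by
          unfold activeProb; rw [if_pos hc, if_neg]; push Not; exact ⟨hcY, d, hd, hdY⟩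
        simp [e1, e2, hcX, hcY]
    · have := hag c hc
      unfold activeProb
      by_cases hcX : c ∈ X
      · simp [hc, hcX, this.1 hcX]
      · have hcY : c ∉ Y := mt this.2 hcX
        simp [hc, hcX, hcY]
  · push Not at hag
    obtain ⟨c, hc, hxy⟩ := hag
    have z1 : permKernel W σ X Y = 0 := by
      refine Finset.prod_eq_zero (Finset.mem_univ c) ?_
      unfold activeProb
      by_cases h1 : c ∈ X <;> by_cases h2 : c ∈ Y <;> simp_all
    have z2 : permKernel W σ Y X = 0 := by
      refine Finset.prod_eq_zero (Finset.mem_univ c) ?_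
      unfold activeProb
      by_cases h1 : c ∈ X <;> by_cases h2 : c ∈ Y <;> simp_all
    rw [z1, z2, mul_zero, mul_zero]

lemma transition_nonneg (X Y : Schedule N) : 0 ≤ transition W X Y := by
  rw [transition_apply]
  exact Finset.sum_nonneg fun σ _ => mul_nonneg (by positivity) (permKernel_nonneg W σ _ _)

lemma sum_transition (X : Schedule N) : ∑ Y, transition W X Y = 1 := by
  simp only [transition_apply]
  rw [Finset.sum_comm]
  simp only [← Finset.mul_sum, sum_permKernel]
  have : (N.factorial : ℝ) ≠ 0 := by positivity
  simp [Fintype.card_perm, this]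

lemma partition_pos : 0 < ∑ Y : Schedule N, Real.exp (∑ c ∈ Y.1, W c) :=
  Finset.sum_pos (fun _ _ => Real.exp_pos _) Finset.univ_nonempty

lemma productForm_pos (X : Schedule N) : 0 < productForm W X :=
  div_pos (Real.exp_pos _) (partition_pos W)

lemma sum_productForm : ∑ X, productForm W X = 1 := by
  unfold productForm
  rw [← Finset.sum_div, div_self (partition_pos W).ne']

lemma transition_reversible (X Y : Schedule N) :
    productForm W X * transition W X Y = productForm W Y * transition W Y X := by
  unfold productForm
  rw [div_mul_eq_mul_div, div_mul_eq_mul_div, transition_apply, transition_apply,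
    Finset.mul_sum, Finset.mul_sum]
  congr 1
  refine Finset.sum_congr rfl fun σ _ => ?_
  rw [mul_left_comm, permKernel_reversible, mul_left_comm]

variable {W}

/-- A schedule is contained in a permutation. -/
lemma Schedule.exists_perm (X : Schedule N) : ∃ σ : Equiv.Perm (Fin N), ∀ c ∈ X.1, σ c.1 = c.2 := by
  classical
  obtain ⟨X, hX⟩ := X
  rw [isSchedule_iff] at hX
  let s : Set (Fin N) := {i | ∃ j, (i, j) ∈ X}
  let φ : Fin N → Fin N := fun i => if h : ∃ j, (i, j) ∈ X then h.choose else i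
  have hφ : ∀ i ∈ s, (i, φ i) ∈ X := by
    intro i hi
    simp only [φ, dif_pos (show ∃ j, (i, j) ∈ X from hi)]
    exact Exists.choose_spec (show ∃ j, (i, j) ∈ X from hi)
  have hinj : Set.InjOn φ s := by
    intro i hi k hk hik
    by_contra hne
    exact hX _ (hφ i hi) _ (hφ k hk) ⟨fun h => hne (congrArg Prod.fst h), Or.inr hik⟩
  obtain ⟨e, he⟩ := Set.MapsTo.exists_equiv_extend_of_card_eq (t := Finset.univ) (f := φ) (s := s)
    (by simp) (fun _ _ => by simp) hinj
  refine ⟨e.trans (Equiv.subtypeUnivEquiv (by simp)), fun c hc => ?_⟩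
  have hs : c.1 ∈ s := ⟨c.2, hc⟩
  have h1 : (e c.1 : Fin N) = φ c.1 := he _ hs
  have h2 : φ c.1 = c.2 := by
    by_contra hne
    exact hX _ (hφ _ hs) _ hc ⟨fun h => hne (congrArg Prod.snd h), Or.inl rfl⟩
  simpa using h1.trans h2

/-- From every schedule the chain reaches the empty schedule in one slot, with a probability
bounded below in terms of the largest weight: it suffices that the selected permutation contains
the schedule and that all its crosspoints are switched off. -/
lemma le_transition_empty {M : ℝ} (hM : ∀ c, W c ≤ M) (X : Schedule N) :
    1 / ((N.factorial : ℝ) * (1 + Real.exp M) ^ (N ^ 2)) ≤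
      transition W X ⟨∅, isSchedule_empty N⟩ := by
  obtain ⟨σ, hσ⟩ := X.exists_perm
  rw [transition_apply]
  refine le_trans ?_ (Finset.single_le_sum (f := fun σ : Equiv.Perm (Fin N) =>
    (1 / (N.factorial : ℝ)) * permKernel W σ X.1 ∅)
    (fun σ _ => mul_nonneg (by positivity) (permKernel_nonneg W σ _ _)) (Finset.mem_univ σ))
  rw [← one_div_mul_one_div]
  refine mul_le_mul_of_nonneg_left ?_ (by positivity)
  have hcard : (1 / (1 + Real.exp M) ^ (N ^ 2) : ℝ) =
      ∏ _c : Crosspoint N, 1 / (1 + Real.exp M) := by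
    simp [Finset.prod_const, Finset.card_univ, sq]
  rw [hcard]
  unfold permKernel
  refine Finset.prod_le_prod (fun _ _ => by positivity) fun c _ => ?_
  rw [if_neg (by simp)]
  have h1 : 1 / (1 + Real.exp M) ≤ 1 - actProb (W c) := by
    rw [one_sub_actProb]
    have := Real.exp_le_exp.2 (hM c)
    gcongr
  refine h1.trans (sub_le_sub_left ?_ 1)
  unfold activeProb
  split_ifs with h2 h3 h3
  · exact le_rfl
  · exact (actProb_pos _).le
  · exact absurd (hσ c h3) h2
  · exact (actProb_pos _).le

end Kernel

/-! ### Spectral gap of a reversible chain with an atom -/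

section Spectral

variable {Ω : Type*} [Fintype Ω]

/-- Doeblin's condition bounds every eigenvalue with a non-constant eigenvector: one step
contracts the oscillation of a function by the factor `1 - c`. -/
lemma abs_eigenvalue_le_of_doeblin {P : Matrix Ω Ω ℝ} (hP0 : ∀ x y, 0 ≤ P x y)
    (hP1 : ∀ x, ∑ y, P x y = 1) {ω : Ω} {c : ℝ} (hc : ∀ x, c ≤ P x ω)
    {v : Ω → ℝ} {e : ℝ} (hv : P.mulVec v = e • v) (hne : ∃ x y, v x ≠ v y) :
    |e| ≤ 1 - c := by
  classical
  obtain ⟨x0, y0, hxy⟩ := hne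
  have : Nonempty Ω := ⟨x0⟩
  obtain ⟨a, ha⟩ := Finite.exists_max v
  obtain ⟨b, hb⟩ := Finite.exists_min v
  have hab : v b < v a := by
    rcases lt_or_gt_of_ne hxy with h | h
    · linarith [ha y0, hb x0]
    · linarith [ha x0, hb y0]
  have hmul : ∀ x, ∑ y, P x y * v y = e * v x := fun x => by
    simpa [Matrix.mulVec, dotProduct] using congrFun hv x
  have hup : ∀ x, e * v x ≤ c * v ω + (1 - c) * v a := by
    intro x
    have h1 : ∑ y, P x y * (v a - v y) = v a - e * v x := by
      simp only [mul_sub, Finset.sum_sub_distrib, ← Finset.sum_mul, hP1, hmul, one_mul]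
    have h2 : P x ω * (v a - v ω) ≤ ∑ y, P x y * (v a - v y) :=
      Finset.single_le_sum (f := fun y => P x y * (v a - v y))
        (fun y _ => mul_nonneg (hP0 x y) (sub_nonneg.2 (ha y))) (Finset.mem_univ ω)
    have h3 := mul_le_mul_of_nonneg_right (hc x) (sub_nonneg.2 (ha ω))
    linarith
  have hlo : ∀ x, c * v ω + (1 - c) * v b ≤ e * v x := by
    intro x
    have h1 : ∑ y, P x y * (v y - v b) = e * v x - v b := by
      simp only [mul_sub, Finset.sum_sub_distrib, ← Finset.sum_mul, hP1, hmul, one_mul]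
    have h2 : P x ω * (v ω - v b) ≤ ∑ y, P x y * (v y - v b) :=
      Finset.single_le_sum (f := fun y => P x y * (v y - v b))
        (fun y _ => mul_nonneg (hP0 x y) (sub_nonneg.2 (hb y))) (Finset.mem_univ ω)
    have h3 := mul_le_mul_of_nonneg_right (hc x) (sub_nonneg.2 (hb ω))
    linarith
  have hpos : 0 < v a - v b := sub_pos.2 hab
  refine abs_le.2 ⟨?_, ?_⟩
  · refine le_of_mul_le_mul_right ?_ hpos
    linarith [hup b, hlo a]
  · refine le_of_mul_le_mul_right ?_ hpos
    linarith [hup a, hlo b]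

/-- The norm of a signed measure `ρ` in `L²(1/π)`; for `ρ = μ - π` its square is the chi-square
divergence of `μ` from `π`. -/
noncomputable def chiNorm (π ρ : Ω → ℝ) : ℝ := √(∑ x, ρ x ^ 2 / π x)

lemma chiNorm_eq_norm {π : Ω → ℝ} (hπ : ∀ x, 0 < π x) (ρ : Ω → ℝ) :
    chiNorm π ρ = ‖(WithLp.toLp 2 fun x => ρ x / √(π x) : EuclideanSpace ℝ Ω)‖ := by
  rw [EuclideanSpace.norm_eq, chiNorm]
  congr 1
  refine Finset.sum_congr rfl fun x _ => ?_
  simp only [Real.norm_eq_abs, sq_abs, div_pow, Real.sq_sqrt (hπ x).le]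

lemma chiNorm_add_le {π : Ω → ℝ} (hπ : ∀ x, 0 < π x) (ρ τ : Ω → ℝ) :
    chiNorm π (fun x => ρ x + τ x) ≤ chiNorm π ρ + chiNorm π τ := by
  rw [chiNorm_eq_norm hπ, chiNorm_eq_norm hπ, chiNorm_eq_norm hπ]
  refine le_of_eq_of_le ?_ (norm_add_le _ _)
  congr 1
  ext x
  simp [add_div]

variable [DecidableEq Ω]

/-- The moduli whose supremum is `eMax P` are bounded by `1 - c` under Doeblin's condition. -/
lemma abs_eigenvalue_le_of_ne_one {P : Matrix Ω Ω ℝ} (hP0 : ∀ x y, 0 ≤ P x y)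
    (hP1 : ∀ x, ∑ y, P x y = 1) {ω : Ω} {c : ℝ} (hc : ∀ x, c ≤ P x ω) {e : ℝ}
    (he : Module.End.HasEigenvalue (Matrix.toLin' P) e) (h1 : |e| ≠ 1) : |e| ≤ 1 - c := by
  obtain ⟨v, hv⟩ := he.exists_hasEigenvector
  have hmul : P.mulVec v = e • v := by simpa using hv.apply_eq_smul
  refine abs_eigenvalue_le_of_doeblin hP0 hP1 hc hmul ?_
  by_contra! hcon
  apply h1
  obtain ⟨x, hx⟩ := Function.ne_iff.1 hv.2
  have h2 : P.mulVec v x = v x := by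
    simp only [Matrix.mulVec, dotProduct]
    rw [Finset.sum_congr rfl fun y _ => by rw [hcon y x], ← Finset.sum_mul, hP1, one_mul]
  rw [hmul] at h2
  have h3 : e = 1 := by
    have : e * v x = 1 * v x := by simpa using h2
    exact mul_right_cancel₀ hx this
  simp [h3]

lemma eMax_nonneg (P : Matrix Ω Ω ℝ) : 0 ≤ eMax P :=
  Real.sSup_nonneg (by rintro _ ⟨e, -, -, rfl⟩; exact abs_nonneg e)

lemma eMax_le_of_doeblin {P : Matrix Ω Ω ℝ} (hP0 : ∀ x y, 0 ≤ P x y)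
    (hP1 : ∀ x, ∑ y, P x y = 1) {ω : Ω} {c : ℝ} (hc : ∀ x, c ≤ P x ω) :
    eMax P ≤ 1 - c := by
  refine Real.sSup_le ?_ ?_
  · rintro _ ⟨e, he, h1, rfl⟩
    exact abs_eigenvalue_le_of_ne_one hP0 hP1 hc he h1
  · have h := Finset.single_le_sum (f := fun y => P ω y) (fun y _ => hP0 ω y) (Finset.mem_univ ω)
    simp only [hP1] at h
    linarith [hc ω]

lemma le_eMax_of_doeblin {P : Matrix Ω Ω ℝ} (hP0 : ∀ x y, 0 ≤ P x y)
    (hP1 : ∀ x, ∑ y, P x y = 1) {ω : Ω} {c : ℝ} (hc : ∀ x, c ≤ P x ω) {e : ℝ}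
    (he : Module.End.HasEigenvalue (Matrix.toLin' P) e) (h1 : |e| ≠ 1) : |e| ≤ eMax P :=
  le_csSup ⟨1 - c, by
    rintro _ ⟨e, he, h1, rfl⟩
    exact abs_eigenvalue_le_of_ne_one hP0 hP1 hc he h1⟩ ⟨e, he, h1, rfl⟩

/-- A reversible kernel contracts signed measures of total mass zero in `L²(1/π)` by the factor
`eMax`. After conjugation by `√π` the kernel is symmetric, and an eigenvector whose eigenvalue has
modulus one is a multiple of `√π`, hence orthogonal to the conjugated measure. -/
lemma chiNorm_vecMul_le {P : Matrix Ω Ω ℝ} (hP0 : ∀ x y, 0 ≤ P x y)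
    (hP1 : ∀ x, ∑ y, P x y = 1) {ω : Ω} {c : ℝ} (hc0 : 0 < c) (hc : ∀ x, c ≤ P x ω)
    {π : Ω → ℝ} (hπ : ∀ x, 0 < π x) (hrev : ∀ x y, π x * P x y = π y * P y x)
    {ρ : Ω → ℝ} (hρ : ∑ x, ρ x = 0) :
    chiNorm π (Matrix.vecMul ρ P) ≤ eMax P * chiNorm π ρ := by
  have hs : ∀ x, 0 < √(π x) := fun x => Real.sqrt_pos.2 (hπ x)
  have hss : ∀ x, √(π x) * √(π x) = π x := fun x => Real.mul_self_sqrt (hπ x).le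
  let A : Matrix Ω Ω ℝ := fun x y => √(π x) * P x y / √(π y)
  have hAsymm : ∀ x y, A x y = A y x := by
    intro x y
    simp only [A]
    rw [div_eq_div_iff (hs y).ne' (hs x).ne']
    have := hrev x y
    rw [← hss x, ← hss y] at this
    linarith
  have hA : A.IsHermitian := by
    ext x y
    simpa [Matrix.conjTranspose_apply] using hAsymm y x
  let u : EuclideanSpace ℝ Ω := WithLp.toLp 2 fun x => ρ x / √(π x)
  let Au : EuclideanSpace ℝ Ω := WithLp.toLp 2 (A.mulVec u)
  have hnu : chiNorm π ρ = ‖u‖ := chiNorm_eq_norm hπ ρ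
  have hnAu : chiNorm π (Matrix.vecMul ρ P) = ‖Au‖ := by
    rw [chiNorm_eq_norm hπ]
    congr 1
    ext y
    have : Au y = Matrix.vecMul ρ P y / √(π y) := by
      simp only [Au, Matrix.mulVec, Matrix.vecMul, dotProduct, Finset.sum_div]
      refine Finset.sum_congr rfl fun x _ => ?_
      rw [hAsymm]
      simp only [A, u]
      have := (hs x).ne'
      have := (hs y).ne'
      field_simp
    exact this.symm
  rw [hnu, hnAu]
  let B := hA.eigenvectorBasis
  have hcoef : ∀ i, inner ℝ (B i) Au = hA.eigenvalues i * inner ℝ (B i) u := by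
    intro i
    have h1 := hA.mulVec_eigenvectorBasis i
    have h2 : ∀ a b : EuclideanSpace ℝ Ω, inner ℝ a b = ∑ x, a x * b x := by
      intro a b
      simp [PiLp.inner_apply, mul_comm]
    have h3 : ∀ x, ∑ y, A x y * B i y = hA.eigenvalues i * B i x := fun x => by
      simpa [Matrix.mulVec, dotProduct] using congrFun h1 x
    rw [h2, h2]
    simp only [Au, Matrix.mulVec, dotProduct, Finset.mul_sum]
    rw [Finset.sum_comm]
    refine Finset.sum_congr rfl fun y _ => ?_
    rw [← mul_assoc, ← h3, Finset.sum_mul]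
    refine Finset.sum_congr rfl fun x _ => ?_
    rw [hAsymm]
    ring
  have hterm : ∀ i, ‖inner ℝ (B i) Au‖ ^ 2 ≤ eMax P ^ 2 * ‖inner ℝ (B i) u‖ ^ 2 := by
    intro i
    rw [hcoef, norm_mul, mul_pow]
    let v : Ω → ℝ := fun x => B i x / √(π x)
    have hBv : ∀ x, B i x = √(π x) * v x := fun x => by
      simp only [v]; field_simp [(hs x).ne']
    have hv : P.mulVec v = hA.eigenvalues i • v := by
      funext x
      have h1 := congrFun (hA.mulVec_eigenvectorBasis i) x
      have h3 : ∑ y, A x y * B i y = hA.eigenvalues i * B i x := by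
        simpa [Matrix.mulVec, dotProduct] using h1
      simp only [Matrix.mulVec, dotProduct, Pi.smul_apply, smul_eq_mul]
      refine mul_left_cancel₀ (hs x).ne' ?_
      rw [mul_left_comm, ← hBv, ← h3, Finset.mul_sum]
      refine Finset.sum_congr rfl fun y _ => ?_
      simp only [A, v]
      ring
    have hv0 : v ≠ 0 := by
      intro h0
      have : B i = 0 := by
        ext x
        rw [hBv, h0]
        simp
      have h1 := B.orthonormal.1 i
      rw [this] at h1
      simp at h1
    by_cases hconst : ∃ x y, v x ≠ v y
    · have hle := abs_eigenvalue_le_of_doeblin hP0 hP1 hc hv hconst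
      have hev : Module.End.HasEigenvalue (Matrix.toLin' P) (hA.eigenvalues i) :=
        Module.End.hasEigenvalue_of_hasEigenvector
          (x := v) ⟨Module.End.mem_eigenspace_iff.2 (by simpa using hv), hv0⟩
      have h2 := le_eMax_of_doeblin hP0 hP1 hc hev (by intro h; linarith)
      rw [Real.norm_eq_abs]
      gcongr
    · push Not at hconst
      have : inner ℝ (B i) u = 0 := by
        have h2 : inner ℝ (B i) u = ∑ x, B i x * u x := by
          simp [PiLp.inner_apply, mul_comm]
        obtain ⟨x0, -⟩ := Function.ne_iff.1 hv0
        have h4 : ∀ x, B i x * u x = v x0 * ρ x := fun x => by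
          rw [hBv, hconst x x0]
          simp only [u]
          field_simp [(hs x).ne']
        rw [h2, Finset.sum_congr rfl fun x _ => h4 x, ← Finset.mul_sum, hρ, mul_zero]
      rw [this]
      simp
  refine abs_le_of_sq_le_sq' ?_ (mul_nonneg (eMax_nonneg P) (norm_nonneg _)) |>.2
  rw [mul_pow, ← B.sum_sq_norm_inner_right Au, ← B.sum_sq_norm_inner_right u, Finset.mul_sum]
  exact Finset.sum_le_sum fun i _ => hterm i

end Spectral

/-! ### Comparison of measures in the chi-square norm -/

section Compare

variable {Ω : Type*} [Fintype Ω]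

lemma chiNorm_nonneg (π ρ : Ω → ℝ) : 0 ≤ chiNorm π ρ := Real.sqrt_nonneg _

lemma tvDist_le_chiNorm {μ π : Ω → ℝ} (hπ : ∀ x, 0 < π x) (hπ1 : ∑ x, π x = 1) :
    tvDist μ π ≤ 1 / 2 * chiNorm π (fun x => μ x - π x) := by
  unfold tvDist chiNorm
  refine mul_le_mul_of_nonneg_left (Real.le_sqrt_of_sq_le ?_) (by norm_num)
  have h := Finset.sum_sq_le_sum_mul_sum_of_sq_le_mul (Finset.univ : Finset Ω)
    (r := fun x => |μ x - π x|) (f := fun x => (μ x - π x) ^ 2 / π x) (g := π)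
    (fun x _ => div_nonneg (sq_nonneg _) (hπ x).le) (fun x _ => (hπ x).le)
    (fun x _ => by rw [sq_abs, div_mul_cancel₀ _ (hπ x).ne'])
  rwa [hπ1, mul_one] at h

lemma tvDist_le_one {μ π : Ω → ℝ} (hμ : ∀ x, 0 ≤ μ x) (hμ1 : ∑ x, μ x = 1)
    (hπ : ∀ x, 0 ≤ π x) (hπ1 : ∑ x, π x = 1) : tvDist μ π ≤ 1 := by
  unfold tvDist
  have : ∑ x, |μ x - π x| ≤ ∑ x, (μ x + π x) := Finset.sum_le_sum fun x _ => by
    rw [abs_le]; constructor <;> linarith [hμ x, hπ x]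
  rw [Finset.sum_add_distrib, hμ1, hπ1] at this
  linarith

lemma chiNorm_le_of_le {π π' : Ω → ℝ} (hπ : ∀ x, 0 < π x) (hπ' : ∀ x, 0 < π' x) {β : ℝ}
    (h : ∀ x, π x ≤ Real.exp β * π' x) (ρ : Ω → ℝ) :
    chiNorm π' ρ ≤ Real.exp (β / 2) * chiNorm π ρ := by
  unfold chiNorm
  have he : Real.exp (β / 2) = √(Real.exp β) := Real.exp_half β
  rw [he, ← Real.sqrt_mul (Real.exp_pos _).le, Finset.mul_sum]
  refine Real.sqrt_le_sqrt (Finset.sum_le_sum fun x _ => ?_)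
  rw [← mul_div_assoc, div_le_div_iff₀ (hπ' x) (hπ x)]
  nlinarith [mul_le_mul_of_nonneg_left (h x) (sq_nonneg (ρ x))]

lemma chiNorm_sub_le {π π' : Ω → ℝ} (hπ' : ∀ x, 0 < π' x) (hπ1 : ∑ x, π' x = 1) {β : ℝ}
    (hβ : 0 ≤ β) (h : ∀ x, π x ≤ Real.exp β * π' x) (h' : ∀ x, π' x ≤ Real.exp β * π x) :
    chiNorm π' (fun x => π x - π' x) ≤ Real.exp β - 1 := by
  have he : 1 ≤ Real.exp β := Real.one_le_exp hβ
  unfold chiNorm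
  refine Real.sqrt_le_iff.2 ⟨by linarith, ?_⟩
  have hsum : (Real.exp β - 1) ^ 2 = ∑ x, (Real.exp β - 1) ^ 2 * π' x := by
    rw [← Finset.mul_sum, hπ1, mul_one]
  rw [hsum]
  refine Finset.sum_le_sum fun x _ => ?_
  rw [div_le_iff₀ (hπ' x), mul_assoc, ← sq, ← mul_pow]
  have h1 := h x
  have h2 := h' x
  have h3 := hπ' x
  have hp : 0 ≤ π x := nonneg_of_mul_nonneg_right (h3.le.trans h2) (Real.exp_pos β)
  -- `π / π' ≥ exp (-β) ≥ 2 - exp β`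
  have h4 : (2 - Real.exp β) * Real.exp β ≤ 1 := by nlinarith [sq_nonneg (Real.exp β - 1)]
  have h5 : (2 - Real.exp β) * π' x ≤ π x := by
    rcases le_total (2 - Real.exp β) 0 with h6 | h6
    · nlinarith
    · nlinarith [mul_le_mul_of_nonneg_left h2 h6]
  refine sq_le_sq' ?_ ?_ <;> simp only <;> linarith

/-- Every law is within `√K` of `π` when `π` has all its masses at least `1 / K`. -/
lemma chiNorm_sub_le_sqrt {μ π : Ω → ℝ} (hμ : ∀ x, 0 ≤ μ x) (hμ1 : ∑ x, μ x = 1)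
    (hπ : ∀ x, 0 < π x) (hπ1 : ∑ x, π x = 1) {K : ℝ} (hK : ∀ x, 1 / π x ≤ K) :
    chiNorm π (fun x => μ x - π x) ≤ √K := by
  unfold chiNorm
  refine Real.sqrt_le_sqrt ?_
  have h1 : ∀ x, (μ x - π x) ^ 2 / π x = μ x ^ 2 / π x - 2 * μ x + π x := fun x => by
    have := (hπ x).ne'
    field_simp
    ring
  have h2 : ∀ x, μ x ^ 2 / π x ≤ K * μ x := fun x => by
    have hle : μ x ≤ 1 := by
      rw [← hμ1]
      exact Finset.single_le_sum (fun y _ => hμ y) (Finset.mem_univ x)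
    have h3 : μ x ^ 2 / π x = (1 / π x) * (μ x * μ x) := by ring
    rw [h3]
    have h4 : 0 ≤ 1 / π x := (one_div_pos.2 (hπ x)).le
    calc (1 / π x) * (μ x * μ x) ≤ (1 / π x) * μ x := by
          refine mul_le_mul_of_nonneg_left ?_ h4
          nlinarith [hμ x]
      _ ≤ K * μ x := mul_le_mul_of_nonneg_right (hK x) (hμ x)
  simp only [h1, Finset.sum_add_distrib, Finset.sum_sub_distrib, ← Finset.mul_sum, hμ1, hπ1]
  have h5 := Finset.sum_le_sum fun x (_ : x ∈ Finset.univ) => h2 x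
  rw [← Finset.mul_sum, hμ1] at h5
  linarith

end Compare

/-! ### Mixing of the chain along slowly varying weights -/

section Mixing

variable {N : ℕ}

/-- The product form changes by at most the factor `exp β` when the weights change by `β` in
total. -/
lemma productForm_le_exp_mul (W W' : Crosspoint N → ℝ) (X : Schedule N) :
    productForm W X ≤ Real.exp (∑ c, |W' c - W c|) * productForm W' X := by
  classical
  unfold productForm
  rw [← mul_div_assoc, div_le_div_iff₀ (partition_pos W) (partition_pos W'), Finset.mul_sum,
    Finset.mul_sum]
  refine Finset.sum_le_sum fun Y _ => ?_
  rw [← Real.exp_add, ← Real.exp_add, ← Real.exp_add, Real.exp_le_exp]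
  rw [← Finset.univ_inter X.1, ← Finset.univ_inter Y.1]
  simp only [← Finset.sum_ite_mem, ← Finset.sum_add_distrib]
  refine Finset.sum_le_sum fun c _ => ?_
  split_ifs <;> linarith [le_abs_self (W' c - W c), neg_abs_le (W' c - W c)]

lemma one_div_productForm_le {W : Crosspoint N → ℝ} {M : ℝ} (h0 : ∀ c, 0 ≤ W c)
    (hM : ∀ c, W c ≤ M) (X : Schedule N) :
    1 / productForm W X ≤ Real.exp ((N : ℝ) ^ 2 * (Real.log 2 + M)) := by
  classical
  unfold productForm
  rw [one_div_div]
  have h1 : 1 ≤ Real.exp (∑ c ∈ X.1, W c) := Real.one_le_exp (Finset.sum_nonneg fun c _ => h0 c)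
  refine (div_le_self (partition_pos W).le h1).trans ?_
  have h2 : ∀ Y : Schedule N, Real.exp (∑ c ∈ Y.1, W c) ≤ Real.exp ((N : ℝ) ^ 2 * M) := by
    intro Y
    rw [Real.exp_le_exp]
    calc ∑ c ∈ Y.1, W c ≤ ∑ c : Crosspoint N, W c :=
          Finset.sum_le_sum_of_subset_of_nonneg (Finset.subset_univ _) fun c _ _ => h0 c
      _ ≤ ∑ _c : Crosspoint N, M := Finset.sum_le_sum fun c _ => hM c
      _ = (N : ℝ) ^ 2 * M := by simp [sq]
  have h3 : (Fintype.card (Schedule N) : ℝ) ≤ 2 ^ (N ^ 2) := by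
    have h := Fintype.card_le_of_injective (Subtype.val : Schedule N → Finset (Crosspoint N))
      Subtype.val_injective
    rw [Fintype.card_finset] at h
    simp only [Fintype.card_prod, Fintype.card_fin, ← sq] at h
    exact_mod_cast h
  calc ∑ Y : Schedule N, Real.exp (∑ c ∈ Y.1, W c)
      ≤ ∑ _Y : Schedule N, Real.exp ((N : ℝ) ^ 2 * M) := Finset.sum_le_sum fun Y _ => h2 Y
    _ = (Fintype.card (Schedule N) : ℝ) * Real.exp ((N : ℝ) ^ 2 * M) := by simp
    _ ≤ 2 ^ (N ^ 2) * Real.exp ((N : ℝ) ^ 2 * M) := by gcongr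
    _ = Real.exp ((N : ℝ) ^ 2 * (Real.log 2 + M)) := by
        rw [mul_add, Real.exp_add]
        congr 1
        rw [mul_comm, Real.exp_mul, Real.exp_log two_pos]
        exact_mod_cast (Real.rpow_natCast 2 (N ^ 2)).symm

lemma exists_doeblin (W : Crosspoint N → ℝ) :
    ∃ c : ℝ, 0 < c ∧ ∀ X, c ≤ transition W X ⟨∅, isSchedule_empty N⟩ :=
  ⟨_, by positivity, le_transition_empty (M := ∑ c, |W c|) fun c =>
    (le_abs_self _).trans (Finset.single_le_sum (f := fun c => |W c|) (fun _ _ => abs_nonneg _)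
      (Finset.mem_univ c))⟩

lemma eMax_transition_lt_one (W : Crosspoint N → ℝ) : eMax (transition W) < 1 := by
  obtain ⟨c, hc0, hc⟩ := exists_doeblin W
  have := eMax_le_of_doeblin (transition_nonneg W) (sum_transition W) hc
  linarith

lemma one_le_mixTime (W : Crosspoint N → ℝ) : 1 ≤ mixTime W := by
  have h1 := eMax_transition_lt_one W
  have h0 := eMax_nonneg (transition W)
  unfold mixTime
  rw [le_div_iff₀ (by linarith)]
  linarith

/-- The mixing time is at most a power of `exp M`, where `M` bounds the weights. -/
lemma mixTime_le {W : Crosspoint N → ℝ} {M : ℝ} (hM : ∀ c, W c ≤ M) :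
    mixTime W ≤ (N.factorial : ℝ) * (1 + Real.exp M) ^ (N ^ 2) := by
  have h := eMax_le_of_doeblin (transition_nonneg W) (sum_transition W) (le_transition_empty hM)
  unfold mixTime
  rw [one_div_le (by linarith [eMax_transition_lt_one W]) (by positivity)]
  linarith

lemma sum_vecMul_transition (W : Crosspoint N → ℝ) (ρ : Schedule N → ℝ) :
    ∑ Y, Matrix.vecMul ρ (transition W) Y = ∑ X, ρ X := by
  simp only [Matrix.vecMul, dotProduct]
  rw [Finset.sum_comm]
  simp only [← Finset.mul_sum, sum_transition, mul_one]

lemma productForm_vecMul_transition (W : Crosspoint N → ℝ) :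
    Matrix.vecMul (productForm W) (transition W) = productForm W := by
  funext Y
  simp only [Matrix.vecMul, dotProduct]
  simp only [transition_reversible W _ Y, ← Finset.mul_sum, sum_transition, mul_one]

/-- One slot of the chain while the weights change from `W` to `W'`: the change of the reference
measure costs a factor `exp (β / 2)` and a term `exp β - 1`, and the transition gains the factor
`eMax = 1 - 1 / T`. -/
lemma chiNorm_step (W W' : Crosspoint N → ℝ) {μ : Schedule N → ℝ} (hμ : ∑ X, μ X = 1) :
    chiNorm (productForm W') (fun X => Matrix.vecMul μ (transition W') X - productForm W' X) ≤
      (1 - 1 / mixTime W') * (Real.exp ((∑ c, |W' c - W c|) / 2) *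
        chiNorm (productForm W) (fun X => μ X - productForm W X) +
          (Real.exp (∑ c, |W' c - W c|) - 1)) := by
  obtain ⟨c, hc0, hc⟩ := exists_doeblin W'
  have hT : 1 - 1 / mixTime W' = eMax (transition W') := by
    unfold mixTime; rw [one_div_one_div]; ring
  rw [hT]
  have h1 := chiNorm_vecMul_le (transition_nonneg W') (sum_transition W') hc0 hc
    (productForm_pos W') (transition_reversible W') (ρ := fun X => μ X - productForm W' X)
    (by rw [Finset.sum_sub_distrib, hμ, sum_productForm, sub_self])
  have h2 : Matrix.vecMul (fun X => μ X - productForm W' X) (transition W') =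
      fun X => Matrix.vecMul μ (transition W') X - productForm W' X := by
    have : (fun X => μ X - productForm W' X) = μ - productForm W' := rfl
    rw [this, Matrix.sub_vecMul, productForm_vecMul_transition]
    rfl
  rw [h2] at h1
  refine h1.trans (mul_le_mul_of_nonneg_left ?_ (eMax_nonneg _))
  have h3 : (fun X => μ X - productForm W' X) = fun X =>
      (μ X - productForm W X) + (productForm W X - productForm W' X) := by
    funext X; ring
  rw [h3]
  refine (chiNorm_add_le (productForm_pos W') _ _).trans (add_le_add ?_ ?_)
  · exact chiNorm_le_of_le (productForm_pos W) (productForm_pos W') (productForm_le_exp_mul W W') _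
  · refine chiNorm_sub_le (productForm_pos W') (sum_productForm W')
      (Finset.sum_nonneg fun _ _ => abs_nonneg _) (productForm_le_exp_mul W W') fun X => ?_
    have := productForm_le_exp_mul W' W X
    simpa only [abs_sub_comm] using this

/-- The excess of the chi-square distance over `δ` contracts by `exp (-x ^ 2)` in a slot with
spectral gap `x`, if the change `β` of the weights is at most `δ x / 8`. -/
lemma excess_contraction {δ x β a a' D : ℝ} (hδ0 : 0 ≤ δ) (hδ1 : δ ≤ 1) (hx0 : 0 ≤ x)
    (hx1 : x ≤ 1) (hβ0 : 0 ≤ β) (hβ : β ≤ δ * x / 8) (hD : 0 ≤ D)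
    (haD : a - δ ≤ D)
    (ha' : a' ≤ (1 - x) * (Real.exp (β / 2) * a + (Real.exp β - 1))) :
    a' - δ ≤ Real.exp (-x ^ 2) * D := by
  have hδx : δ * x ≤ x := mul_le_of_le_one_left hx0 hδ1
  have hβ1 : β ≤ 1 := by linarith
  have e1 : Real.exp (β / 2) ≤ 1 + x / 8 := by
    have := Real.exp_bound_div_one_sub_of_interval (x := β / 2) (by linarith) (by linarith)
    refine this.trans ?_
    rw [div_le_iff₀ (by linarith)]
    nlinarith
  have e2 : Real.exp β - 1 ≤ δ * x / 4 := by
    have := Real.exp_bound_div_one_sub_of_interval (x := β) (by linarith) (by linarith)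
    have h2 : 1 / (1 - β) - 1 ≤ δ * x / 4 := by
      rw [sub_le_iff_le_add, div_le_iff₀ (by linarith)]
      nlinarith
    linarith
  have e3 : 1 - x ^ 2 ≤ Real.exp (-x ^ 2) := by
    have := Real.add_one_le_exp (-x ^ 2)
    linarith
  have h1 : Real.exp (β / 2) * a ≤ (1 + x / 8) * (δ + D) :=
    calc Real.exp (β / 2) * a ≤ Real.exp (β / 2) * (δ + D) :=
          mul_le_mul_of_nonneg_left (by linarith) (Real.exp_pos _).le
      _ ≤ (1 + x / 8) * (δ + D) := mul_le_mul_of_nonneg_right e1 (by linarith)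
  have h2 : a' ≤ (1 - x) * ((1 + x / 8) * (δ + D) + δ * x / 4) :=
    ha'.trans (mul_le_mul_of_nonneg_left (add_le_add h1 e2) (by linarith))
  -- the gap `x` enters squared because the loss `1 + x / 8` is absorbed by
  -- `(1 - x) * (1 + x) = 1 - x ^ 2`
  have h3 : (1 - x) * (1 + x / 8) * D ≤ Real.exp (-x ^ 2) * D :=
    mul_le_mul_of_nonneg_right (by nlinarith) hD
  have h4 : (1 - x) * (1 + x / 8 + x / 4) * δ ≤ 1 * δ :=
    mul_le_mul_of_nonneg_right (by nlinarith) hδ0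
  linarith

/-- Along weights that vary slowly from time `m` on, the excess of the chi-square distance over
`δ` decays like `exp (-∑ 1 / T ^ 2)`. -/
lemma chiNorm_le_of_slow {W : ℕ → Crosspoint N → ℝ} {μ : ℕ → Schedule N → ℝ} {m : ℕ}
    (hμ : ∀ n, μ (n + 1) = Matrix.vecMul (μ n) (transition (W (n + 1))))
    (hμ1 : ∀ n, ∑ X, μ n X = 1) {δ : ℝ} (hδ0 : 0 ≤ δ) (hδ1 : δ ≤ 1)
    (hslow : ∀ n, m ≤ n → (∑ c, |W (n + 1) c - W n c|) * mixTime (W (n + 1)) ≤ δ / 8)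
    {A : ℝ} (hA : chiNorm (productForm (W m)) (fun X => μ m X - productForm (W m) X) ≤ A)
    {n : ℕ} (hn : m ≤ n) :
    chiNorm (productForm (W n)) (fun X => μ n X - productForm (W n) X) ≤
      δ + Real.exp (-∑ i ∈ Finset.Icc (m + 1) n, 1 / mixTime (W i) ^ 2) * A := by
  have hA0 : 0 ≤ A := (chiNorm_nonneg _ _).trans hA
  induction n, hn using Nat.le_induction with
  | base => simp; linarith
  | succ n hn ih =>
    have hT := one_le_mixTime (W (n + 1))
    have hT0 : 0 < mixTime (W (n + 1)) := by linarith
    have hstep := chiNorm_step (W n) (W (n + 1)) (hμ1 n)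
    rw [← hμ] at hstep
    have hβ := hslow n hn
    have := excess_contraction hδ0 hδ1 (x := 1 / mixTime (W (n + 1))) (by positivity)
      (by rw [div_le_one hT0]; exact hT) (Finset.sum_nonneg fun _ _ => abs_nonneg _)
      (by
        rw [← le_div_iff₀ hT0] at hβ
        refine hβ.trans (le_of_eq ?_)
        ring)
      (mul_nonneg (Real.exp_pos _).le hA0) (sub_le_iff_le_add'.2 ih) hstep
    rw [Finset.sum_Icc_succ_top (by omega), neg_add_rev, Real.exp_add]
    rw [one_div_pow] at this
    linarith

end Mixing

/-! ### The weight function -/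

/-- The standing assumptions on the function `g` in `f(x) = log (1 + x) / g(x)`. -/
structure IsWeightDivisor (g : ℝ → ℝ) : Prop where
  diff : DifferentiableOn ℝ g (Set.Ici 0)
  one_le : ∀ x, 0 ≤ x → 1 ≤ g x
  deriv_nonneg : ∀ x, 0 ≤ x → 0 ≤ derivWithin g (Set.Ici 0) x
  bijOn : Set.BijOn (weightFun g) (Set.Ici 0) (Set.Ici 0)
  tendsto : Tendsto (fun x => g (invOnNonneg (weightFun g) x)) atTop atTop

namespace IsWeightDivisor

variable {g : ℝ → ℝ}

lemma monotoneOn (hg : IsWeightDivisor g) : MonotoneOn g (Set.Ici 0) := by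
  refine monotoneOn_of_deriv_nonneg (convex_Ici 0) hg.diff.continuousOn
    (hg.diff.mono interior_subset) fun x hx => ?_
  rw [interior_Ici] at hx
  rw [← derivWithin_of_mem_nhds (Ici_mem_nhds hx)]
  exact hg.deriv_nonneg x (le_of_lt hx)

lemma weightFun_nonneg (hg : IsWeightDivisor g) {x : ℝ} (hx : 0 ≤ x) : 0 ≤ weightFun g x :=
  hg.bijOn.mapsTo hx

lemma differentiableOn_log : DifferentiableOn ℝ (fun x : ℝ => Real.log (1 + x)) (Set.Ici 0) := by
  intro x hx
  have hx' : (0 : ℝ) ≤ x := hx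
  have : (1 + x : ℝ) ≠ 0 := by positivity
  fun_prop (disch := assumption)

lemma differentiableOn (hg : IsWeightDivisor g) :
    DifferentiableOn ℝ (weightFun g) (Set.Ici 0) :=
  differentiableOn_log.div hg.diff fun x hx => (zero_lt_one.trans_le (hg.one_le x hx)).ne'

lemma strictMonoOn (hg : IsWeightDivisor g) : StrictMonoOn (weightFun g) (Set.Ici 0) := by
  intro x hx y hy hxy
  have hx' : (0 : ℝ) ≤ x := hx
  have hsub : Set.Icc 0 y ⊆ Set.Ici (0 : ℝ) := fun z hz => hz.1
  have h0 : weightFun g 0 ≤ weightFun g y := by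
    have : weightFun g 0 = 0 := by simp [weightFun]
    rw [this]
    exact hg.weightFun_nonneg hy
  exact ContinuousOn.strictMonoOn_of_injOn_Icc hy h0 (hg.differentiableOn.continuousOn.mono hsub)
    (hg.bijOn.injOn.mono hsub) ⟨hx', hxy.le⟩ ⟨hy, le_rfl⟩ hxy

lemma weightFun_le_weightFun (hg : IsWeightDivisor g) {x y : ℝ} (hx : 0 ≤ x) (hxy : x ≤ y) :
    weightFun g x ≤ weightFun g y :=
  hg.strictMonoOn.monotoneOn hx (hx.trans hxy) hxy

/-- Since `g` increases, the increments of `f` are dominated by those of `log (1 + x)`. -/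
lemma sub_le_log_sub (hg : IsWeightDivisor g) {x y : ℝ} (hx : 0 ≤ x) (hxy : x ≤ y) :
    weightFun g y - weightFun g x ≤ Real.log (1 + y) - Real.log (1 + x) := by
  have hL : 0 ≤ Real.log (1 + x) := Real.log_nonneg (by linarith)
  have hL' : Real.log (1 + x) ≤ Real.log (1 + y) := Real.log_le_log (by linarith) (by linarith)
  have hgx := hg.one_le x hx
  have hgy := hg.one_le y (hx.trans hxy)
  have hm := hg.monotoneOn hx (hx.trans hxy) hxy
  have h1 : Real.log (1 + x) / g y ≤ Real.log (1 + x) / g x :=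
    div_le_div_of_nonneg_left hL (by linarith) hm
  have h2 : (Real.log (1 + y) - Real.log (1 + x)) / g y ≤ Real.log (1 + y) - Real.log (1 + x) :=
    div_le_self (by linarith) hgy
  rw [sub_div] at h2
  unfold weightFun
  linarith

lemma sub_le_one_div (hg : IsWeightDivisor g) {x y : ℝ} (hx : 0 ≤ x) (hy : 0 ≤ y)
    (hxy : y ≤ x + 1) : weightFun g y - weightFun g x ≤ 1 / (1 + x) := by
  rcases le_total x y with h | h
  · refine (hg.sub_le_log_sub hx h).trans ?_
    rw [← Real.log_div (by linarith) (by linarith)]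
    have := Real.log_le_sub_one_of_pos (x := (1 + y) / (1 + x)) (by positivity)
    refine this.trans ?_
    rw [div_sub_one (by linarith)]
    gcongr
    linarith
  · have := hg.weightFun_le_weightFun hy h
    have h2 : 0 ≤ 1 / (1 + x) := by positivity
    linarith

lemma derivWithin_le (hg : IsWeightDivisor g) {x : ℝ} (hx : 0 ≤ x) :
    derivWithin (weightFun g) (Set.Ici 0) x ≤ 1 / (1 + x) := by
  have hmono : MonotoneOn (fun y => Real.log (1 + y) - weightFun g y) (Set.Ici 0) := by
    intro y hy z hz hyz
    have := hg.sub_le_log_sub hy hyz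
    simp only
    linarith
  have h1 : HasDerivWithinAt (fun y : ℝ => Real.log (1 + y)) (1 / (1 + x)) (Set.Ici 0) x := by
    have := ((hasDerivAt_id x).const_add 1).log (by simp only [id]; positivity)
    exact this.hasDerivWithinAt
  have h2 := h1.sub (hg.differentiableOn x hx).hasDerivWithinAt
  have h3 := hmono.derivWithin_nonneg (x := x)
  have h4 := h2.derivWithin (uniqueDiffOn_Ici 0 x hx)
  have h5 : derivWithin (fun y => Real.log (1 + y) - weightFun g y) (Set.Ici 0) x =
      1 / (1 + x) - derivWithin (weightFun g) (Set.Ici 0) x := h4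
  rw [h5] at h3
  linarith

lemma derivWithin_nonneg (hg : IsWeightDivisor g) (x : ℝ) :
    0 ≤ derivWithin (weightFun g) (Set.Ici 0) x :=
  hg.strictMonoOn.monotoneOn.derivWithin_nonneg

lemma inv_nonneg (hg : IsWeightDivisor g) {y : ℝ} (hy : 0 ≤ y) :
    0 ≤ invOnNonneg (weightFun g) y :=
  Function.invFunOn_mem (hg.bijOn.surjOn hy)

lemma weightFun_inv (hg : IsWeightDivisor g) {y : ℝ} (hy : 0 ≤ y) :
    weightFun g (invOnNonneg (weightFun g) y) = y :=
  Function.invFunOn_eq (hg.bijOn.surjOn hy)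

lemma le_weightFun (hg : IsWeightDivisor g) {x y : ℝ} (hy : 0 ≤ y)
    (h : invOnNonneg (weightFun g) y ≤ x) : y ≤ weightFun g x := by
  have := hg.weightFun_le_weightFun (hg.inv_nonneg hy) h
  rwa [hg.weightFun_inv hy] at this

lemma inv_le_iff (hg : IsWeightDivisor g) {x y : ℝ} (hx : 0 ≤ x) (hy : 0 ≤ y) :
    invOnNonneg (weightFun g) y ≤ x ↔ y ≤ weightFun g x := by
  rw [← hg.strictMonoOn.le_iff_le (hg.inv_nonneg hy) hx, hg.weightFun_inv hy]

lemma le_inv_iff (hg : IsWeightDivisor g) {x y : ℝ} (hx : 0 ≤ x) (hy : 0 ≤ y) :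
    x ≤ invOnNonneg (weightFun g) y ↔ weightFun g x ≤ y := by
  rw [← hg.strictMonoOn.le_iff_le hx (hg.inv_nonneg hy), hg.weightFun_inv hy]

lemma exists_le_of_le (hg : IsWeightDivisor g) (K : ℝ) :
    ∃ x₀, 0 ≤ x₀ ∧ ∀ x, x₀ ≤ x → K ≤ g x := by
  obtain ⟨y, hy⟩ := ((hg.tendsto.eventually_ge_atTop K).and (eventually_ge_atTop 0)).exists
  have h0 := hg.inv_nonneg hy.2
  exact ⟨_, h0, fun x hx => hy.1.trans (hg.monotoneOn h0 (h0.trans hx) hx)⟩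

lemma exp_mul_weightFun (hg : IsWeightDivisor g) {x : ℝ} (hx : 0 ≤ x) :
    Real.exp (g x * weightFun g x) = 1 + x := by
  have h := hg.one_le x hx
  unfold weightFun
  rw [mul_div_cancel₀ _ (by linarith), Real.exp_log (by linarith)]

/-- Every exponential of `f` grows at most linearly, because `g → ∞`. -/
lemma exists_exp_le (hg : IsWeightDivisor g) (K : ℝ) :
    ∃ A, 0 < A ∧ ∀ x, 0 ≤ x → Real.exp (K * weightFun g x) ≤ A * (1 + x) := by
  obtain ⟨x₀, hx₀, hK⟩ := hg.exists_le_of_le |K|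
  have hf₀ := hg.weightFun_nonneg hx₀
  refine ⟨Real.exp (|K| * weightFun g x₀), Real.exp_pos _, fun x hx => ?_⟩
  have hf := hg.weightFun_nonneg hx
  have h1 : 1 ≤ Real.exp (|K| * weightFun g x₀) := Real.one_le_exp (by positivity)
  have h2 : Real.exp (K * weightFun g x) ≤ Real.exp (|K| * weightFun g x) :=
    Real.exp_le_exp.2 (mul_le_mul_of_nonneg_right (le_abs_self K) hf)
  refine h2.trans ?_
  rcases le_total x₀ x with h | h
  · have h3 : Real.exp (|K| * weightFun g x) ≤ 1 + x := by
      rw [← hg.exp_mul_weightFun hx]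
      exact Real.exp_le_exp.2 (mul_le_mul_of_nonneg_right (hK x h) hf)
    nlinarith
  · have h3 : Real.exp (|K| * weightFun g x) ≤ Real.exp (|K| * weightFun g x₀) :=
      Real.exp_le_exp.2 (mul_le_mul_of_nonneg_left (hg.weightFun_le_weightFun hx h)
        (abs_nonneg K))
    nlinarith

/-- The quantity `1 + f⁻¹ (c f(x))` eventually dominates every exponential of `f`, because it
equals `exp (c g(f⁻¹ (c f(x))) f(x))`, in which the factor `g` tends to infinity. -/
lemma exists_exp_div_le (hg : IsWeightDivisor g) {c : ℝ} (hc : 0 < c) (K : ℝ) {η : ℝ}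
    (hη : 0 < η) : ∃ R, 0 ≤ R ∧ ∀ x y, R ≤ x → 0 ≤ y → y ≤ x + 1 →
      1 / (1 + invOnNonneg (weightFun g) (c * weightFun g x)) *
        Real.exp (|K| * weightFun g y) ≤ η := by
  obtain ⟨x₀, hx₀, hK⟩ := hg.exists_le_of_le ((|K| + 1) / c)
  have hf₀ := hg.weightFun_nonneg hx₀
  set Y : ℝ := max (weightFun g x₀ / c) (|K| - Real.log η) with hY
  have hY0 : 0 ≤ Y := le_max_of_le_left (by positivity)
  refine ⟨invOnNonneg (weightFun g) Y, hg.inv_nonneg hY0, fun x y hx hy0 hy => ?_⟩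
  have hx0 : 0 ≤ x := (hg.inv_nonneg hY0).trans hx
  have hfx : Y ≤ weightFun g x := hg.le_weightFun hY0 hx
  have hf0 : 0 ≤ c * weightFun g x := mul_nonneg hc.le (hg.weightFun_nonneg hx0)
  set z := invOnNonneg (weightFun g) (c * weightFun g x) with hz
  have hz0 : 0 ≤ z := hg.inv_nonneg hf0
  have hzx : x₀ ≤ z := by
    rw [hz, hg.le_inv_iff hx₀ hf0, mul_comm, ← div_le_iff₀ hc]
    exact (le_max_left _ _).trans hfx
  have h1 : (|K| + 1) * weightFun g x ≤ g z * weightFun g z := by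
    rw [hz, hg.weightFun_inv hf0, ← hz, ← mul_assoc]
    refine mul_le_mul_of_nonneg_right ?_ (hg.weightFun_nonneg hx0)
    rw [← div_le_iff₀ hc]
    exact hK z hzx
  have hfy : weightFun g y ≤ weightFun g x + 1 := by
    have h2 := hg.sub_le_one_div hx0 hy0 hy
    have h3 : 1 / (1 + x) ≤ 1 := by rw [div_le_one (by linarith)]; linarith
    linarith
  rw [← hg.exp_mul_weightFun hz0, one_div, ← Real.exp_neg, ← Real.exp_add,
    ← Real.le_log_iff_exp_le hη]
  have h4 : |K| * weightFun g y ≤ |K| * (weightFun g x + 1) :=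
    mul_le_mul_of_nonneg_left hfy (abs_nonneg K)
  have h5 : |K| - Real.log η ≤ weightFun g x := (le_max_right _ _).trans hfx
  linarith

/-- A concave `f` grows over a step of length at most one by no more than its derivative at the
starting point. -/
lemma sub_le_derivWithin (hg : IsWeightDivisor g) (hf : ConcaveOn ℝ (Set.Ici 0) (weightFun g))
    {x y : ℝ} (hx : 0 ≤ x) (hy : 0 ≤ y) (hxy : y ≤ x + 1) :
    weightFun g y - weightFun g x ≤ derivWithin (weightFun g) (Set.Ici 0) x := by
  have hd := hg.derivWithin_nonneg x
  rcases lt_or_ge x y with h | h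
  · have h1 := hf.slope_le_derivWithin hx hy h (hg.differentiableOn x hx)
    rw [slope_def_field, div_le_iff₀ (by linarith)] at h1
    nlinarith
  · have := hg.weightFun_le_weightFun hy h
    linarith

end IsWeightDivisor

/-- Increments over unit steps of a concave function decrease. -/
lemma ConcaveOn.sub_le_sub_of_add_one {f : ℝ → ℝ} (hf : ConcaveOn ℝ (Set.Ici 0) f) {x y : ℝ}
    (hx : 0 ≤ x) (hxy : x ≤ y) : f (y + 1) - f y ≤ f (x + 1) - f x := by
  have ht : 0 < y + 1 - x := by linarith
  have hy1 : y + 1 ∈ Set.Ici (0 : ℝ) := by simp only [Set.mem_Ici]; linarith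
  have a0 : 0 ≤ (y - x) / (y + 1 - x) := div_nonneg (by linarith) ht.le
  have b0 : 0 ≤ 1 / (y + 1 - x) := by positivity
  have ab : (y - x) / (y + 1 - x) + 1 / (y + 1 - x) = 1 := by field_simp; ring
  have h1 := hf.2 (show x ∈ Set.Ici (0 : ℝ) from hx) hy1 a0 b0 ab
  have h2 := hf.2 (show x ∈ Set.Ici (0 : ℝ) from hx) hy1 b0 a0 (by rw [add_comm]; exact ab)
  have e1 : (y - x) / (y + 1 - x) * x + 1 / (y + 1 - x) * (y + 1) = x + 1 := by
    field_simp; ring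
  have e2 : 1 / (y + 1 - x) * x + (y - x) / (y + 1 - x) * (y + 1) = y := by
    field_simp; ring
  simp only [smul_eq_mul] at h1 h2
  rw [e1] at h1
  rw [e2] at h2
  have h3 : ((y - x) / (y + 1 - x) + 1 / (y + 1 - x)) * (f x + f (y + 1)) ≤ f (x + 1) + f y := by
    linarith
  rw [ab] at h3
  linarith

/-! ### The weights along a queue path -/

section Queue

variable {N : ℕ} {g : ℝ → ℝ} {ε : ℝ}

/-- The lower bound `f⁻¹ (ε / (2 N²) * f (Q_max))` imposed on the modified queue lengths. -/
noncomputable def qFloor (f : ℝ → ℝ) (ε : ℝ) (q : Crosspoint N → ℕ) : ℝ :=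
  invOnNonneg f (ε / (2 * (N : ℝ) ^ 2) * f (qMax q))

lemma le_qMax (q : Crosspoint N → ℕ) (c : Crosspoint N) : (q c : ℝ) ≤ qMax q := by
  exact_mod_cast Finset.le_sup (f := q) (Finset.mem_univ c)

lemma qMax_le_add_one {q q' : Crosspoint N → ℕ} (h : ∀ c, q' c ≤ q c + 1) :
    (qMax q' : ℝ) ≤ qMax q + 1 := by
  have : qMax q' ≤ qMax q + 1 := Finset.sup_le fun c _ =>
    (h c).trans (Nat.add_le_add_right (Finset.le_sup (f := q) (Finset.mem_univ c)) 1)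
  exact_mod_cast this

lemma qNorm_le_mul_qMax (q : Crosspoint N → ℕ) : qNorm q ≤ N * qMax q := by
  unfold qNorm
  rw [Real.sqrt_le_left (by positivity)]
  calc ∑ c, (q c : ℝ) ^ 2 ≤ ∑ _c : Crosspoint N, (qMax q : ℝ) ^ 2 :=
        Finset.sum_le_sum fun c _ => pow_le_pow_left₀ (by positivity) (le_qMax q c) 2
    _ = (N * qMax q : ℝ) ^ 2 := by simp; ring

section Weights

variable (hN : 1 ≤ N) (hε0 : 0 < ε) (hε1 : ε < 1)
include hN hε0

lemma floorCoeff_pos : 0 < ε / (2 * (N : ℝ) ^ 2) := by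
  have : (0 : ℝ) < N := by exact_mod_cast hN
  positivity

include hε1 in
lemma floorCoeff_le_one : ε / (2 * (N : ℝ) ^ 2) ≤ 1 := by
  have h : (1 : ℝ) ≤ N := by exact_mod_cast hN
  rw [div_le_one (by positivity)]
  nlinarith

variable (hg : IsWeightDivisor g)
include hg

lemma floorCoeff_mul_nonneg (q : Crosspoint N → ℕ) :
    0 ≤ ε / (2 * (N : ℝ) ^ 2) * weightFun g (qMax q) :=
  mul_nonneg (floorCoeff_pos hN hε0).le (hg.weightFun_nonneg (Nat.cast_nonneg _))

lemma qFloor_nonneg (q : Crosspoint N → ℕ) : 0 ≤ qFloor (weightFun g) ε q :=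
  hg.inv_nonneg (floorCoeff_mul_nonneg hN hε0 hg q)

lemma weightFun_qFloor (q : Crosspoint N → ℕ) :
    weightFun g (qFloor (weightFun g) ε q) =
      ε / (2 * (N : ℝ) ^ 2) * weightFun g (qMax q) :=
  hg.weightFun_inv (floorCoeff_mul_nonneg hN hε0 hg q)

omit hN hε0 hg in
lemma qFloor_le_qTilde (q : Crosspoint N → ℕ) (c : Crosspoint N) :
    qFloor (weightFun g) ε q ≤ qTilde (weightFun g) ε q c := le_max_left _ _

lemma qTilde_nonneg (q : Crosspoint N → ℕ) (c : Crosspoint N) :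
    0 ≤ qTilde (weightFun g) ε q c :=
  (qFloor_nonneg hN hε0 hg q).trans (qFloor_le_qTilde q c)

include hε1

lemma qFloor_le_qMax (q : Crosspoint N → ℕ) : qFloor (weightFun g) ε q ≤ qMax q := by
  unfold qFloor
  rw [hg.inv_le_iff (Nat.cast_nonneg _) (floorCoeff_mul_nonneg hN hε0 hg q)]
  exact mul_le_of_le_one_left (hg.weightFun_nonneg (Nat.cast_nonneg _))
    (floorCoeff_le_one hN hε0 hε1)

omit hε1 in
lemma weight_nonneg (q : Crosspoint N → ℕ) (c : Crosspoint N) :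
    0 ≤ weight (weightFun g) ε q c :=
  hg.weightFun_nonneg (qTilde_nonneg hN hε0 hg q c)

lemma weight_le (q : Crosspoint N → ℕ) (c : Crosspoint N) :
    weight (weightFun g) ε q c ≤ weightFun g (qMax q) :=
  hg.weightFun_le_weightFun (qTilde_nonneg hN hε0 hg q c)
    (max_le (qFloor_le_qMax hN hε0 hε1 hg q) (le_qMax q c))

lemma mixTime_weight_le (q : Crosspoint N → ℕ) :
    mixTime (weight (weightFun g) ε q) ≤
      (N.factorial * 2 ^ (N ^ 2) : ℝ) * Real.exp ((N : ℝ) ^ 2 * weightFun g (qMax q)) := by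
  refine (mixTime_le (weight_le hN hε0 hε1 hg q)).trans ?_
  have h1 : 1 ≤ Real.exp (weightFun g (qMax q)) :=
    Real.one_le_exp (hg.weightFun_nonneg (Nat.cast_nonneg _))
  have h2 : Real.exp ((N : ℝ) ^ 2 * weightFun g (qMax q)) =
      Real.exp (weightFun g (qMax q)) ^ (N ^ 2) := by
    rw [← Real.exp_nat_mul]; push_cast; rfl
  rw [h2, mul_assoc, ← mul_pow]
  gcongr
  linarith

/-- The weight of a crosspoint grows by at most `1 / (1 + qFloor)` in a slot. -/
lemma weight_sub_le {q q' : Crosspoint N → ℕ} (h : ∀ c, q' c ≤ q c + 1) (c : Crosspoint N) :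
    weight (weightFun g) ε q' c - weight (weightFun g) ε q c ≤
      1 / (1 + qFloor (weightFun g) ε q) := by
  have hfl := qFloor_nonneg hN hε0 hg q
  have hfl' := qFloor_nonneg hN hε0 hg q'
  have hqt := qTilde_nonneg hN hε0 hg q c
  have hw : weight (weightFun g) ε q' c =
      max (weightFun g (qFloor (weightFun g) ε q')) (weightFun g (q' c)) :=
    hg.strictMonoOn.monotoneOn.map_max hfl' (Nat.cast_nonneg (q' c) : (0 : ℝ) ≤ q' c)
  rw [hw, sub_le_iff_le_add]
  refine max_le ?_ ?_
  · have h1 := hg.sub_le_one_div (Nat.cast_nonneg (qMax q)) (Nat.cast_nonneg (qMax q'))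
      (qMax_le_add_one h)
    have h2 : (1 : ℝ) / (1 + qMax q) ≤ 1 / (1 + qFloor (weightFun g) ε q) := by
      have := qFloor_le_qMax hN hε0 hε1 hg q
      gcongr
    have h3 : weightFun g (qFloor (weightFun g) ε q) ≤ weight (weightFun g) ε q c :=
      hg.weightFun_le_weightFun hfl (qFloor_le_qTilde q c)
    rw [weightFun_qFloor hN hε0 hg] at h3 ⊢
    have h4 : ε / (2 * (N : ℝ) ^ 2) * (weightFun g (qMax q') - weightFun g (qMax q)) ≤
        1 / (1 + qFloor (weightFun g) ε q) := by
      have h5 := mul_le_mul_of_nonneg_left (h1.trans h2) (floorCoeff_pos hN hε0).le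
      have h6 := mul_le_of_le_one_left (a := ε / (2 * (N : ℝ) ^ 2))
        (show 0 ≤ 1 / (1 + qFloor (weightFun g) ε q) by positivity)
        (floorCoeff_le_one hN hε0 hε1)
      exact h5.trans h6
    linarith
  · have h0 : (q' c : ℝ) ≤ qTilde (weightFun g) ε q c + 1 := by
      have h1 : (q' c : ℝ) ≤ q c + 1 := by exact_mod_cast h c
      have h2 : (q c : ℝ) ≤ qTilde (weightFun g) ε q c := le_max_right _ _
      linarith
    have h1 := hg.sub_le_one_div hqt (Nat.cast_nonneg _) h0
    have h2 : (1 : ℝ) / (1 + qTilde (weightFun g) ε q c) ≤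
        1 / (1 + qFloor (weightFun g) ε q) := by
      have := qFloor_le_qTilde (g := g) (ε := ε) q c
      gcongr
    have h3 : weightFun g (qTilde (weightFun g) ε q c) = weight (weightFun g) ε q c := rfl
    linarith

/-- When the queues are long, the sum of the reciprocals of the floors before and after a slot is
small compared with the inverse mixing time after it. -/
lemma exists_floor_mul_mixTime_le {η : ℝ} (hη : 0 < η) :
    ∃ C : ℝ, ∀ Q : ℕ → Crosspoint N → ℕ, IsQueuePath Q → ∀ n, C < qNorm (Q n) →
      (∑ _c : Crosspoint N, (1 / (1 + qFloor (weightFun g) ε (Q n)) +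
        1 / (1 + qFloor (weightFun g) ε (Q (n + 1))))) *
          mixTimeAt (weightFun g) ε Q (n + 1) ≤ η := by
  have hN0 : (0 : ℝ) < N := by exact_mod_cast hN
  set B : ℝ := N.factorial * 2 ^ (N ^ 2) with hB
  have hB0 : 0 < B := by positivity
  obtain ⟨R, hR0, hR⟩ := hg.exists_exp_div_le (floorCoeff_pos hN hε0) ((N : ℝ) ^ 2)
    (η := η / (2 * N ^ 2 * B)) (by positivity)
  rw [abs_of_nonneg (by positivity)] at hR
  refine ⟨N * (R + 1), fun Q hQ n hn => ?_⟩
  have hn1 : R + 1 ≤ qMax (Q n) := by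
    have := hn.le.trans (qNorm_le_mul_qMax (Q n))
    exact le_of_mul_le_mul_left this hN0
  have hup : (qMax (Q (n + 1)) : ℝ) ≤ qMax (Q n) + 1 := qMax_le_add_one fun c => (hQ n c).1
  have hdown : (qMax (Q n) : ℝ) ≤ qMax (Q (n + 1)) + 1 := qMax_le_add_one fun c => (hQ n c).2
  have h1 := hR (qMax (Q n)) (qMax (Q (n + 1))) (by linarith) (Nat.cast_nonneg _) hup
  have h2 := hR (qMax (Q (n + 1))) (qMax (Q (n + 1))) (by linarith) (Nat.cast_nonneg _)
    (by linarith)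
  have hT := mixTime_weight_le hN hε0 hε1 hg (Q (n + 1))
  have hf1 := qFloor_nonneg hN hε0 hg (Q n)
  have hf2 := qFloor_nonneg hN hε0 hg (Q (n + 1))
  rw [Finset.sum_const, Finset.card_univ, Fintype.card_prod, Fintype.card_fin, nsmul_eq_mul]
  push_cast
  refine (mul_le_mul_of_nonneg_left hT (by positivity)).trans ?_
  rw [← hB]
  have h3 : ((N : ℝ) * N * B) * (1 / (1 + qFloor (weightFun g) ε (Q n)) *
      Real.exp ((N : ℝ) ^ 2 * weightFun g (qMax (Q (n + 1)))) +
        1 / (1 + qFloor (weightFun g) ε (Q (n + 1))) *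
          Real.exp ((N : ℝ) ^ 2 * weightFun g (qMax (Q (n + 1))))) ≤
      ((N : ℝ) * N * B) * (η / (2 * N ^ 2 * B) + η / (2 * N ^ 2 * B)) :=
    mul_le_mul_of_nonneg_left (add_le_add h1 h2) (by positivity)
  have h4 : ((N : ℝ) * N * B) * (η / (2 * N ^ 2 * B) + η / (2 * N ^ 2 * B)) = η := by
    field_simp
    ring
  linarith

omit hε1 in
/-- `α_n` is bounded through the floors of the modified queue lengths, since `f' ≤ 1 / (1 + x)`. -/
lemma alphaSeq_le (Q : ℕ → Crosspoint N → ℕ) (n : ℕ) :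
    alphaSeq (weightFun g) ε Q n ≤ ∑ _c : Crosspoint N,
      (1 / (1 + qFloor (weightFun g) ε (Q n)) +
        1 / (1 + qFloor (weightFun g) ε (Q (n + 1)))) := by
  have key : ∀ (q : Crosspoint N → ℕ) (c : Crosspoint N),
      derivWithin (weightFun g) (Set.Ici 0) (qTilde (weightFun g) ε q c) ≤
        1 / (1 + qFloor (weightFun g) ε q) := by
    intro q c
    refine (hg.derivWithin_le (qTilde_nonneg hN hε0 hg q c)).trans ?_
    have h1 := qFloor_le_qTilde (g := g) (ε := ε) q c
    have h2 := qFloor_nonneg hN hε0 hg q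
    gcongr
  exact Finset.sum_le_sum fun c _ => add_le_add (key _ c) (key _ c)

lemma sum_abs_weight_sub_le {Q : ℕ → Crosspoint N → ℕ} (hQ : IsQueuePath Q) (n : ℕ) :
    ∑ c, |weight (weightFun g) ε (Q (n + 1)) c - weight (weightFun g) ε (Q n) c| ≤
      ∑ _c : Crosspoint N, (1 / (1 + qFloor (weightFun g) ε (Q n)) +
        1 / (1 + qFloor (weightFun g) ε (Q (n + 1)))) := by
  refine Finset.sum_le_sum fun c _ => ?_
  have h1 := weight_sub_le hN hε0 hε1 hg (fun c => (hQ n c).1) c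
  have h2 := weight_sub_le hN hε0 hε1 hg (fun c => (hQ n c).2) c
  have hf1 := qFloor_nonneg hN hε0 hg (Q n)
  have hf2 := qFloor_nonneg hN hε0 hg (Q (n + 1))
  have p1 : 0 ≤ 1 / (1 + qFloor (weightFun g) ε (Q n)) := by positivity
  have p2 : 0 ≤ 1 / (1 + qFloor (weightFun g) ε (Q (n + 1))) := by positivity
  rw [abs_le]
  constructor <;> linarith

/-- For concave `f` a modified queue length grows by at most one in a slot. -/
lemma qTilde_le_add_one (hf : ConcaveOn ℝ (Set.Ici 0) (weightFun g)) {q q' : Crosspoint N → ℕ}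
    (h : ∀ c, q' c ≤ q c + 1) (c : Crosspoint N) :
    qTilde (weightFun g) ε q' c ≤ qTilde (weightFun g) ε q c + 1 := by
  have hfl := qFloor_nonneg hN hε0 hg q
  have hfl' := qFloor_nonneg hN hε0 hg q'
  have hfloor : qFloor (weightFun g) ε q' ≤ qFloor (weightFun g) ε q + 1 := by
    refine (hg.strictMonoOn.le_iff_le hfl' (show (0 : ℝ) ≤ _ by linarith)).1 ?_
    have h1 := hf.sub_le_sub_of_add_one hfl (qFloor_le_qMax hN hε0 hε1 hg q)
    have h2 := hg.weightFun_le_weightFun (Nat.cast_nonneg (qMax q')) (qMax_le_add_one h)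
    have h3 := hg.weightFun_le_weightFun (Nat.cast_nonneg (qMax q))
      (show (qMax q : ℝ) ≤ qMax q + 1 by linarith)
    have e1 := weightFun_qFloor hN hε0 hg q
    have e2 := weightFun_qFloor hN hε0 hg q'
    have h4 := mul_le_mul_of_nonneg_left (sub_le_sub_right h2 (weightFun g (qMax q)))
      (floorCoeff_pos hN hε0).le
    have h5 := mul_le_of_le_one_left (sub_nonneg.2 h3) (floorCoeff_le_one hN hε0 hε1)
    rw [e2]
    linarith
  refine max_le ?_ ?_
  · have := qFloor_le_qTilde (g := g) (ε := ε) q c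
    exact hfloor.trans (by linarith)
  · have h1 : (q' c : ℝ) ≤ q c + 1 := by exact_mod_cast h c
    have h2 : (q c : ℝ) ≤ qTilde (weightFun g) ε q c := le_max_right _ _
    linarith

lemma sum_abs_weight_sub_le_alphaSeq (hf : ConcaveOn ℝ (Set.Ici 0) (weightFun g))
    {Q : ℕ → Crosspoint N → ℕ} (hQ : IsQueuePath Q) (n : ℕ) :
    ∑ c, |weight (weightFun g) ε (Q (n + 1)) c - weight (weightFun g) ε (Q n) c| ≤
      alphaSeq (weightFun g) ε Q n := by
  refine Finset.sum_le_sum fun c _ => ?_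
  have n1 := qTilde_nonneg hN hε0 hg (Q n) c
  have n2 := qTilde_nonneg hN hε0 hg (Q (n + 1)) c
  have h1 := hg.sub_le_derivWithin hf n1 n2
    (qTilde_le_add_one hN hε0 hε1 hg hf (fun c => (hQ n c).1) c)
  have h2 := hg.sub_le_derivWithin hf n2 n1
    (qTilde_le_add_one hN hε0 hε1 hg hf (fun c => (hQ n c).2) c)
  have p1 := hg.derivWithin_nonneg (qTilde (weightFun g) ε (Q n) c)
  have p2 := hg.derivWithin_nonneg (qTilde (weightFun g) ε (Q (n + 1)) c)
  unfold weight
  rw [abs_le]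
  constructor <;> linarith

/-- The series `∑ 1 / T ^ 2` diverges: queues grow at most linearly, and the mixing time is
smaller than every power of the longest queue. -/
lemma exists_le_sum_mixTime {Q : ℕ → Crosspoint N → ℕ} (hQ : IsQueuePath Q) (m : ℕ) (S : ℝ) :
    ∃ n₀, m ≤ n₀ ∧ ∀ n, n₀ ≤ n →
      S ≤ ∑ i ∈ Finset.Icc (m + 1) n, 1 / mixTimeAt (weightFun g) ε Q i ^ 2 := by
  obtain ⟨A, hA0, hA⟩ := hg.exists_exp_le (2 * (N : ℝ) ^ 2)
  set B : ℝ := N.factorial * 2 ^ (N ^ 2) with hB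
  have hB0 : 0 < B := by positivity
  have hlin : ∀ i, (qMax (Q i) : ℝ) ≤ qMax (Q 0) + i := by
    intro i
    induction i with
    | zero => simp
    | succ i ih =>
      have := qMax_le_add_one fun c => (hQ i c).1
      push_cast
      linarith
  have hT : ∀ i, mixTimeAt (weightFun g) ε Q i ^ 2 ≤ B ^ 2 * A * (1 + qMax (Q 0) + i) := by
    intro i
    have h1 := mixTime_weight_le hN hε0 hε1 hg (Q i)
    have h0 : 0 ≤ mixTime (weight (weightFun g) ε (Q i)) := zero_le_one.trans (one_le_mixTime _)
    have h2 := pow_le_pow_left₀ h0 h1 2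
    rw [mul_pow, ← Real.exp_nat_mul, ← mul_assoc, ← hB] at h2
    refine h2.trans ?_
    rw [mul_assoc (B ^ 2)]
    refine mul_le_mul_of_nonneg_left ?_ (by positivity)
    refine (hA _ (Nat.cast_nonneg _)).trans ?_
    refine mul_le_mul_of_nonneg_left ?_ hA0.le
    linarith [hlin i]
  have hterm0 : ∀ i, 0 ≤ 1 / mixTimeAt (weightFun g) ε Q (m + 1 + i) ^ 2 := fun i => by
    positivity
  have hdiv : ¬ Summable fun i => 1 / mixTimeAt (weightFun g) ε Q (m + 1 + i) ^ 2 := by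
    intro hs
    have h1 : Summable fun i : ℕ => B ^ 2 * A * (1 / mixTimeAt (weightFun g) ε Q (m + 1 + i) ^ 2) :=
      hs.mul_left _
    have h2 : Summable fun i : ℕ => (1 : ℝ) / ((i + (1 + qMax (Q 0) + (m + 1)) : ℕ) : ℝ) := by
      refine Summable.of_nonneg_of_le (fun i => by positivity) (fun i => ?_) h1
      have hTi := hT (m + 1 + i)
      have hpos : 0 < mixTimeAt (weightFun g) ε Q (m + 1 + i) :=
        zero_lt_one.trans_le (one_le_mixTime _)
      rw [mul_one_div, div_le_div_iff₀ (by positivity) (by positivity), one_mul]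
      refine hTi.trans (le_of_eq ?_)
      push_cast
      ring
    exact Real.not_summable_one_div_natCast
      ((summable_nat_add_iff (f := fun i : ℕ => (1 : ℝ) / (i : ℝ)) _).1 h2)
  rw [not_summable_iff_tendsto_nat_atTop_of_nonneg hterm0] at hdiv
  obtain ⟨k, hk⟩ := (tendsto_atTop_atTop.1 hdiv) S
  refine ⟨m + k, by omega, fun n hn => ?_⟩
  have h1 := hk (n - m) (by omega)
  have h2 : Finset.Icc (m + 1) n = Finset.Ico (m + 1) (n + 1) := by
    ext; simp only [Finset.mem_Icc, Finset.mem_Ico]; omega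
  rw [h2, Finset.sum_Ico_eq_sum_range]
  rwa [show n + 1 - (m + 1) = n - m by omega]

end Weights

/-! ### Convergence of the law of the schedule -/

lemma scheduleLaw_mem_stdSimplex {f : ℝ → ℝ} (Q : ℕ → Crosspoint N → ℕ) {μ₀ : Schedule N → ℝ}
    (hμ₀ : μ₀ ∈ stdSimplex ℝ (Schedule N)) (n : ℕ) :
    scheduleLaw f ε Q μ₀ n ∈ stdSimplex ℝ (Schedule N) := by
  induction n with
  | zero => exact hμ₀
  | succ n ih =>
    refine ⟨fun Y => ?_, ?_⟩
    · exact Finset.sum_nonneg fun X _ => mul_nonneg (ih.1 X) (transition_nonneg _ X Y)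
    · exact (sum_vecMul_transition _ _).trans ih.2

lemma le_maxWeight (W : Crosspoint N → ℝ) (c : Crosspoint N) : W c ≤ maxWeight W :=
  le_ciSup (Set.finite_range W).bddAbove c

/-- Slow variation of the weights from time `m` on makes the law of the schedule close to the
product form as soon as `∑ 1 / T ^ 2` has passed the stated threshold. -/
lemma tvDist_le_of_slow (hN : 1 ≤ N) (hε0 : 0 < ε) (hg : IsWeightDivisor g)
    {Q : ℕ → Crosspoint N → ℕ} {δ : ℝ} (hδ0 : 0 < δ) (hδ1 : δ ≤ 1) {m : ℕ}
    (hslow : ∀ n, m ≤ n →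
      (∑ c, |weight (weightFun g) ε (Q (n + 1)) c - weight (weightFun g) ε (Q n) c|) *
        mixTimeAt (weightFun g) ε Q (n + 1) ≤ δ / 8)
    {μ₀ : Schedule N → ℝ} (hμ₀ : μ₀ ∈ stdSimplex ℝ (Schedule N)) {n : ℕ} (hn : m ≤ n)
    (hS : Real.log (2 / δ) +
        (N : ℝ) ^ 2 / 2 * (Real.log 2 + maxWeight (weight (weightFun g) ε (Q m))) ≤
      ∑ i ∈ Finset.Icc (m + 1) n, 1 / mixTimeAt (weightFun g) ε Q i ^ 2) :
    tvDist (scheduleLaw (weightFun g) ε Q μ₀ n)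
      (productForm (weight (weightFun g) ε (Q n))) ≤ δ := by
  have hlaw := scheduleLaw_mem_stdSimplex (ε := ε) (f := weightFun g) Q hμ₀
  have hA := chiNorm_sub_le_sqrt (hlaw m).1 (hlaw m).2
    (productForm_pos (weight (weightFun g) ε (Q m))) (sum_productForm _)
    (one_div_productForm_le (weight_nonneg hN hε0 hg (Q m)) (le_maxWeight _))
  rw [← Real.exp_half] at hA
  have h1 := chiNorm_le_of_slow (W := fun n => weight (weightFun g) ε (Q n))
    (μ := scheduleLaw (weightFun g) ε Q μ₀) (fun _ => rfl) (fun n => (hlaw n).2) hδ0.le hδ1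
    hslow hA hn
  have h2 := tvDist_le_chiNorm (μ := scheduleLaw (weightFun g) ε Q μ₀ n)
    (productForm_pos (weight (weightFun g) ε (Q n))) (sum_productForm _)
  rw [← Real.exp_add] at h1
  have h3 : Real.exp (-∑ i ∈ Finset.Icc (m + 1) n, 1 / mixTime (weight (weightFun g) ε (Q i)) ^ 2 +
      (N : ℝ) ^ 2 * (Real.log 2 + maxWeight (weight (weightFun g) ε (Q m))) / 2) ≤ δ / 2 := by
    rw [← Real.le_log_iff_exp_le (by positivity)]
    have h4 : Real.log (δ / 2) = -Real.log (2 / δ) := by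
      rw [← Real.log_inv, inv_div]
    unfold mixTimeAt at hS
    linarith
  linarith

end Queue

theorem mainTheorem2 (N : ℕ) (hN : 1 ≤ N) (ε : ℝ) (hε0 : 0 < ε) (hε1 : ε < 1)
    (g : ℝ → ℝ)
    (hg_diff : DifferentiableOn ℝ g (Set.Ici 0))
    (hg_one : ∀ x, 0 ≤ x → 1 ≤ g x)
    (hg_mono : ∀ x, 0 ≤ x → 0 ≤ derivWithin g (Set.Ici 0) x)
    -- the weight function has an inverse on the half-line
    (hf_bij : Set.BijOn (weightFun g) (Set.Ici 0) (Set.Ici 0))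
    (hg_lim : Tendsto (fun x => g (invOnNonneg (weightFun g) x)) atTop atTop) :
    -- the sufficient condition, with the explicit time `n*`
    (ConcaveOn ℝ (Set.Ici 0) (weightFun g) →
      ∀ δ : ℝ, 0 < δ → ∀ Q : ℕ → Crosspoint N → ℕ, IsQueuePath Q →
        (∀ n, alphaSeq (weightFun g) ε Q n * mixTimeAt (weightFun g) ε Q (n + 1) ≤ δ / 8) →
        ∃ nstar : ℕ, IsLeast (convergenceTimes (weightFun g) ε δ Q) nstar ∧
          ∀ μ₀ ∈ stdSimplex ℝ (Schedule N), ∀ n, nstar ≤ n →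
            tvDist (scheduleLaw (weightFun g) ε Q μ₀ n)
              (productForm (weight (weightFun g) ε (Q n))) ≤ δ) ∧
    -- the sufficient condition holds when the queues are long
    (∀ δ : ℝ, 0 < δ → ∃ C : ℝ, ∀ Q : ℕ → Crosspoint N → ℕ, IsQueuePath Q →
      ∀ n, C < qNorm (Q n) →
        alphaSeq (weightFun g) ε Q n * mixTimeAt (weightFun g) ε Q (n + 1) ≤ δ / 8) ∧
    -- convergence
    (∀ δ : ℝ, 0 < δ → ∃ C : ℝ, ∀ Q : ℕ → Crosspoint N → ℕ, IsQueuePath Q →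
      (∀ᶠ n in atTop, C < qNorm (Q n)) →
      ∃ nstar : ℕ, ∀ μ₀ ∈ stdSimplex ℝ (Schedule N), ∀ n, nstar ≤ n →
        tvDist (scheduleLaw (weightFun g) ε Q μ₀ n)
          (productForm (weight (weightFun g) ε (Q n))) ≤ δ) := by
  have hg : IsWeightDivisor g := ⟨hg_diff, hg_one, hg_mono, hf_bij, hg_lim⟩
  have hT0 : ∀ (Q : ℕ → Crosspoint N → ℕ) n, 0 ≤ mixTimeAt (weightFun g) ε Q n :=
    fun Q n => zero_le_one.trans (one_le_mixTime _)
  refine ⟨fun hf δ hδ Q hQ hα => ?_, fun δ hδ => ?_, fun δ hδ => ?_⟩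
  · have hne : (convergenceTimes (weightFun g) ε δ Q).Nonempty := by
      obtain ⟨n₀, -, h⟩ := exists_le_sum_mixTime hN hε0 hε1 hg hQ 0 (Real.log (2 / δ) +
        (N : ℝ) ^ 2 / 2 * (Real.log 2 + maxWeight (weight (weightFun g) ε (Q 0))))
      exact ⟨n₀, by simpa [convergenceTimes] using h n₀ le_rfl⟩
    refine ⟨sInf (convergenceTimes (weightFun g) ε δ Q),
      ⟨Nat.sInf_mem hne, fun n hn => Nat.sInf_le hn⟩, fun μ₀ hμ₀ n hn => ?_⟩
    rcases le_or_gt δ 1 with hδ1 | hδ1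
    · refine tvDist_le_of_slow hN hε0 hg hδ hδ1 (m := 0) (fun n _ => ?_) hμ₀ (Nat.zero_le n) ?_
      · exact (mul_le_mul_of_nonneg_right
          (sum_abs_weight_sub_le_alphaSeq hN hε0 hε1 hg hf hQ n) (hT0 Q _)).trans (hα n)
      · refine (Nat.sInf_mem hne).trans (Finset.sum_le_sum_of_subset_of_nonneg ?_ ?_)
        · exact Finset.Icc_subset_Icc le_rfl hn
        · exact fun i _ _ => by positivity
    · have hlaw := scheduleLaw_mem_stdSimplex (ε := ε) (f := weightFun g) Q hμ₀ n
      exact (tvDist_le_one hlaw.1 hlaw.2 (fun X => (productForm_pos _ X).le)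
        (sum_productForm _)).trans hδ1.le
  · obtain ⟨C, hC⟩ := exists_floor_mul_mixTime_le hN hε0 hε1 hg (η := δ / 8) (by positivity)
    exact ⟨C, fun Q hQ n hn => (mul_le_mul_of_nonneg_right (alphaSeq_le hN hε0 hg Q n)
      (hT0 Q _)).trans (hC Q hQ n hn)⟩
  · have hδ' : 0 < min δ 1 := lt_min hδ one_pos
    obtain ⟨C, hC⟩ := exists_floor_mul_mixTime_le hN hε0 hε1 hg (η := min δ 1 / 8) (by positivity)
    refine ⟨C, fun Q hQ hlong => ?_⟩
    obtain ⟨m, hm⟩ := eventually_atTop.1 hlong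
    obtain ⟨n₀, hmn, hS⟩ := exists_le_sum_mixTime hN hε0 hε1 hg hQ m (Real.log (2 / min δ 1) +
      (N : ℝ) ^ 2 / 2 * (Real.log 2 + maxWeight (weight (weightFun g) ε (Q m))))
    refine ⟨n₀, fun μ₀ hμ₀ n hn => ?_⟩
    refine (tvDist_le_of_slow hN hε0 hg hδ' (min_le_right _ _) (fun k hk => ?_) hμ₀
      (hmn.trans hn) (hS n hn)).trans (min_le_left _ _)
    exact (mul_le_mul_of_nonneg_right (sum_abs_weight_sub_le hN hε0 hε1 hg hQ k)
      (hT0 Q _)).trans (hC Q hQ k (hm k hk))
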